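/- Let $\tau\in\mathbb C$ with $\operatorname{Im}\tau>0$, $\Gamma=\mathbb Z+\tau\mathbb Z$, and let $\theta$ be the entire odd function with $\theta(u+1)=-\theta(u)$, $\theta(u+\tau)=-e^{-2\pi iu-\pi i\tau}\theta(u)$, $\theta'(0)=1$. Let $\mathcal K_0$ be the algebra of germs at $0$ of functions that are meromorphic near $0$ with no pole except possibly at $0$, with the scalar product $\langle s,t\rangle=\operatorname{Res}_{u=0}s(u)t(u)\,du$. Let $\mathfrak{sl}_2$ have the basis $h,e,f$ with $[h,e]=2e$, $[h,f]=-2f$, $[e,f]=h$ and the invariant form with $(h,h)=2$, $(e,f)=1$. Let $\mathfrak e_\tau(\widehat{\mathfrak{sl}}_2)=(\mathfrak{sl}_2\otimes\mathcal K_0)\oplus\mathbb Cc\oplus\mathbb Cd$ be the Lie algebra in which, with $\hat x[s]=x\otimes s$, $[\hat x[s],\hat y[t]]=\widehat{[x,y]}[st]+(x,y)\langle s',t\rangle c$, $[d,\hat x[s]]=\hat x[s']$ and $c$ is central; it carries the invariant form $\langle\hat x[s],\hat y[t]\rangle=(x,y)\langle s,t\rangle$, $\langle c,d\rangle=1$,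 with all other pairings of $c,d,\hat x[s]$ zero. For $n\ge0$ put $\epsilon_{n;\lambda}=(-u)^n$, $\epsilon^{-n-1;\lambda}=u^n$ and $$\epsilon^{n;\lambda}=\frac1{n!}\Big(\frac{\theta(u+\lambda)}{\theta(u)\theta(\lambda)}\Big)^{(n)},\qquad \epsilon_{-n-1;\lambda}=\frac{(-1)^n}{n!}\Big(\frac{\theta(u-\lambda)}{\theta(u)\theta(-\lambda)}\Big)^{(n)}$$ for $\lambda\notin\Gamma$; for $\lambda=0$ both quotients of theta functions are replaced by $\theta'(u)/\theta(u)$. Tensors $a_1\otimes\cdots\otimes a_n$ over $\mathfrak e_\tau(\widehat{\mathfrak{sl}}_2)$ are identified with the functionals $(x_1,\dots,x_n)\mapsto\prod_i\langle a_i,x_i\rangle$; infinite sums of tensors converge pointwise on test elements, and the completed tensor powers consist of the functionals all of whose partial actions (on all arguments but one) are represented by elements of $\mathfrak e_\tau(\widehat{\mathfrak{sl}}_2)$. Let $\lambda\in\mathbb C\setminus\Gamma$. Then: (1) The bases are dual: $\langle\epsilon^{n;\lambda},\epsilon_{m;\lambda}\rangle=\delta_{nm}$ and $\langle\epsilon^{n;0},\epsilon_{m;0}\rangle=\delta_{nm}$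 for all $n,m\in\mathbb Z$. (2) The series $$r_\lambda=\tfrac12\sum_{n\ge0}\hat h[\epsilon^{n;0}]\otimes\hat h[\epsilon_{n;0}]+\sum_{n\ge0}\hat f[\epsilon^{n;\lambda}]\otimes\hat e[\epsilon_{n;\lambda}]+\sum_{n<0}\hat e[\epsilon_{n;\lambda}]\otimes\hat f[\epsilon^{n;\lambda}]+c\otimes d$$ converges in the completed tensor square; it is differentiable in $\lambda$ (pointwise on test elements), and its derivative is again in the completed tensor square. (3) The series obtained by expanding $[r_{\lambda,12},r_{\lambda,13}]$, $[r_{\lambda,12},r_{\lambda,23}]$, $[r_{\lambda,13},r_{\lambda,23}]$ termwise converge, and, with $h=\hat h[1]$, $$[r_{\lambda,12},r_{\lambda,13}]+[r_{\lambda,12},r_{\lambda,23}]+[r_{\lambda,13},r_{\lambda,23}]=h_1\frac{\partial}{\partial\lambda}r_{\lambda,23}-h_2\frac{\partial}{\partial\lambda}r_{\lambda,13}+h_3\frac{\partial}{\partial\lambda}r_{\lambda,12}.$$ (4) $r_{\lambda,12}+r_{\lambda,21}=\Omega$, where $\Omega$ is the tensor Casimir element, i.e. the functional $(x,y)\mapsto\langle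 x,y\rangle$. (5) For every $x$ the series $\delta x=[x\otimes1+1\otimes x,r_\lambda]$ (expanded termwise) converges, and together with $\varphi=-[r_{\lambda,12},r_{\lambda,13}]-[r_{\lambda,12},r_{\lambda,23}]-[r_{\lambda,13},r_{\lambda,23}]$ it makes $\mathfrak e_\tau(\widehat{\mathfrak{sl}}_2)$ a quasi-Lie bialgebra: $\delta$ is linear, $\delta x$ and $\varphi$ are skew-symmetric elements of the completed tensor square and cube, $\delta$ is a 1-cocycle for the adjoint action, $\frac12\operatorname{Alt}(\delta\otimes\mathrm{id})\delta(x)=[x\otimes1\otimes1+1\otimes x\otimes1+1\otimes1\otimes x,\varphi]$ for all $x$, and $\operatorname{Alt}(\delta\otimes\mathrm{id}\otimes\mathrm{id})\varphi=0$, where $\operatorname{Alt}$ is the signed sum over all permutations of the tensor factors. -/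

import Mathlib

noncomputable section
namespace EllipticCurrent
open Filter Topology

/-- The complex functions that are meromorphic at the origin: after restriction to a small
neighbourhood their only possible pole is the origin. -/
def meromorphicAlgebra : Subalgebra ℂ (ℂ → ℂ) where
  carrier := {s | MeromorphicAt s 0}
  mul_mem' hs ht := hs.mul ht
  add_mem' hs ht := hs.add ht
  algebraMap_mem' a := MeromorphicAt.const a 0

/-- The functions that vanish on a punctured neighbourhood of the origin. -/
def vanishingIdeal : Ideal meromorphicAlgebra where
  carrier := {s | ∀ᶠ u in 𝓝[≠] (0 : ℂ), s.1 u = 0}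
  zero_mem' := by
    change ∀ᶠ u in 𝓝[≠] (0 : ℂ), _
    exact Eventually.of_forall fun _ => rfl
  add_mem' := by
    intro s t hs ht
    change ∀ᶠ u in 𝓝[≠] (0 : ℂ), _
    filter_upwards [hs, ht] with u h1 h2
    simp [h1, h2]
  smul_mem' := by
    intro s t ht
    change ∀ᶠ u in 𝓝[≠] (0 : ℂ), _
    filter_upwards [ht] with u h
    simp [h]

/-- The algebra of test functions: germs at the origin of functions that are meromorphic in a
neighbourhood of the origin, with no pole except possibly the origin. -/
def K0 : Type := meromorphicAlgebra ⧸ vanishingIdeal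

instance : CommRing K0 := inferInstanceAs (CommRing (meromorphicAlgebra ⧸ vanishingIdeal))
instance : Algebra ℂ K0 := inferInstanceAs (Algebra ℂ (meromorphicAlgebra ⧸ vanishingIdeal))

/-- The germ of a function. -/
def K0.mk (s : ℂ → ℂ) (hs : MeromorphicAt s 0) : K0 :=
  Ideal.Quotient.mk vanishingIdeal ⟨s, hs⟩

theorem K0.mk_eq_iff {s t : ℂ → ℂ} (hs : MeromorphicAt s 0) (ht : MeromorphicAt t 0) :
    K0.mk s hs = K0.mk t ht ↔ s =ᶠ[𝓝[≠] 0] t := by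
  refine Ideal.Quotient.eq.trans ?_
  change (∀ᶠ u in 𝓝[≠] (0 : ℂ), s u - t u = 0) ↔ _
  simp only [sub_eq_zero]; rfl

theorem K0.ind {p : K0 → Prop} (h : ∀ s hs, p (K0.mk s hs)) (x : K0) : p x := by
  obtain ⟨⟨s, hs⟩, rfl⟩ := Ideal.Quotient.mk_surjective x
  exact h s hs

theorem eventually_differentiableAt {s : ℂ → ℂ} (hs : MeromorphicAt s 0) :
    ∀ᶠ u in 𝓝[≠] (0 : ℂ), DifferentiableAt ℂ s u :=
  hs.eventually_analyticAt.mono fun _ h => h.differentiableAt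

def K0.derivAux : meromorphicAlgebra →ₗ[ℂ] K0 where
  toFun s := K0.mk (deriv s.1) s.2.deriv
  map_add' s t := by
    refine (K0.mk_eq_iff _ (MeromorphicAt.add s.2.deriv t.2.deriv)).2 ?_
    filter_upwards [eventually_differentiableAt s.2, eventually_differentiableAt t.2] with u h1 h2
    exact deriv_add h1 h2
  map_smul' a s := by
    refine (K0.mk_eq_iff _ (MeromorphicAt.mul (MeromorphicAt.const a 0) s.2.deriv)).2 ?_
    filter_upwards [eventually_differentiableAt s.2] with u h1
    exact deriv_const_smul a h1

/-- The derivation `s ↦ s'` of `K0`. -/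
def K0.D : K0 →ₗ[ℂ] K0 :=
  Submodule.liftQ (vanishingIdeal.restrictScalars ℂ) K0.derivAux (by
    intro s hs
    refine (K0.mk_eq_iff _ (MeromorphicAt.const 0 0)).2 ?_
    have h : s.1 =ᶠ[𝓝[≠] 0] (fun _ => (0 : ℂ)) := hs
    simpa using h.nhdsNE_deriv)

theorem K0.D_mk (s : ℂ → ℂ) (hs : MeromorphicAt s 0) : K0.D (K0.mk s hs) = K0.mk (deriv s) hs.deriv := rfl

theorem K0.D_mul (s t : K0) : K0.D (s * t) = K0.D s * t + s * K0.D t := by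
  induction s using K0.ind with | _ s hs
  induction t using K0.ind with | _ t ht
  refine (K0.mk_eq_iff (hs.mul ht).deriv ((hs.deriv.mul ht).add (hs.mul ht.deriv))).2 ?_
  filter_upwards [eventually_differentiableAt hs, eventually_differentiableAt ht] with u h1 h2
  exact deriv_mul h1 h2

theorem K0.D_algebraMap (a : ℂ) : K0.D (algebraMap ℂ K0 a) = 0 := by
  have h1 : K0.D 1 = 0 := by
    have h := K0.D_mul 1 1
    rw [mul_one, mul_one, one_mul] at h
    exact left_eq_add.1 h
  rw [Algebra.algebraMap_eq_smul_one, map_smul, h1, smul_zero]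

/-- The integral of `s(u) du / (2πi)` over the circle of radius `ρ` around the origin. -/
def contourIntegral (s : ℂ → ℂ) (ρ : ℝ) : ℂ :=
  (2 * Real.pi * Complex.I)⁻¹ * ∮ u in C(0, ρ), s u

/-- The residue at the origin, as the limit (in fact, the eventual value) of the integrals over
small circles. -/
def residue (s : ℂ → ℂ) : ℂ := limUnder (𝓝[>] (0 : ℝ)) (contourIntegral s)

theorem eventually_sphere {p : ℂ → Prop} (h : ∀ᶠ u in 𝓝[≠] (0 : ℂ), p u) :
    ∃ ρ > 0, ∀ u : ℂ, 0 < ‖u‖ → ‖u‖ < ρ → p u := by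
  rw [eventually_nhdsWithin_iff, Metric.eventually_nhds_iff] at h
  obtain ⟨ρ, hρ, h⟩ := h
  exact ⟨ρ, hρ, fun u h0 h1 => h (by simpa using h1) (by simpa using h0)⟩

theorem residue_spec {s : ℂ → ℂ} (hs : MeromorphicAt s 0) :
    ∀ᶠ ρ in 𝓝[>] (0 : ℝ), CircleIntegrable s 0 ρ ∧ contourIntegral s ρ = residue s := by
  obtain ⟨r, hr, h⟩ := eventually_sphere (eventually_differentiableAt hs)
  have hci : ∀ ρ : ℝ, 0 < ρ → ρ < r → CircleIntegrable s 0 ρ := by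
    intro ρ h0 h1
    refine ContinuousOn.circleIntegrable h0.le fun u hu => ?_
    have hu : ‖u‖ = ρ := by simpa using hu
    exact (h u (hu ▸ h0) (hu ▸ h1)).continuousAt.continuousWithinAt
  have hconst : ∀ a b : ℝ, 0 < a → a ≤ b → b < r → contourIntegral s b = contourIntegral s a := by
    intro a b ha hab hb
    unfold contourIntegral
    congr 1
    refine Complex.circleIntegral_eq_of_differentiable_on_annulus_off_countable ha hab
      Set.countable_empty ?_ ?_
    · rintro u ⟨h1, h2⟩
      have h1 : ‖u‖ ≤ b := by simpa using h1
      have h2 : a ≤ ‖u‖ := by simpa using h2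
      exact (h u (by linarith) (by linarith)).continuousAt.continuousWithinAt
    · rintro u ⟨⟨h1, h2⟩, -⟩
      have h1 : ‖u‖ < b := by simpa using h1
      have h2 : a < ‖u‖ := by simpa using h2
      exact h u (by linarith) (by linarith)
  have hev : ∀ᶠ ρ in 𝓝[>] (0 : ℝ), contourIntegral s ρ = contourIntegral s (r / 2) := by
    filter_upwards [Ioo_mem_nhdsGT (half_pos hr)] with ρ hρ
    exact (hconst ρ (r / 2) hρ.1 hρ.2.le (by linarith)).symm
  have hlim : residue s = contourIntegral s (r / 2) :=
    Tendsto.limUnder_eq (tendsto_const_nhds.congr' (hev.mono fun _ h => h.symm))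
  filter_upwards [hev, Ioo_mem_nhdsGT hr] with ρ h1 h2
  exact ⟨hci ρ h2.1 h2.2, h1.trans hlim.symm⟩

theorem residue_eq_of {s : ℂ → ℂ} (hs : MeromorphicAt s 0) {c : ℂ}
    (h : ∀ᶠ ρ in 𝓝[>] (0 : ℝ), contourIntegral s ρ = c) : residue s = c := by
  obtain ⟨ρ, h1, h2⟩ := ((residue_spec hs).and h).exists
  exact h1.2.symm.trans h2

theorem residue_congr {s t : ℂ → ℂ} (hs : MeromorphicAt s 0) (ht : MeromorphicAt t 0)
    (h : s =ᶠ[𝓝[≠] 0] t) : residue s = residue t := by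
  refine residue_eq_of hs ?_
  obtain ⟨r, hr, h⟩ := eventually_sphere h
  filter_upwards [residue_spec ht, Ioo_mem_nhdsGT hr] with ρ h1 h2
  rw [← h1.2, contourIntegral, contourIntegral]
  congr 1
  refine circleIntegral.integral_congr h2.1.le fun u hu => ?_
  have hu : ‖u‖ = ρ := by simpa using hu
  exact h u (hu ▸ h2.1) (hu ▸ h2.2)

theorem residue_deriv {s : ℂ → ℂ} (hs : MeromorphicAt s 0) : residue (deriv s) = 0 := by
  refine residue_eq_of hs.deriv ?_
  obtain ⟨r, hr, h⟩ := eventually_sphere (eventually_differentiableAt hs)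
  filter_upwards [Ioo_mem_nhdsGT hr] with ρ h2
  rw [contourIntegral, circleIntegral.integral_eq_zero_of_hasDerivWithinAt' (f := s), mul_zero]
  intro u hu
  have hu : ‖u‖ = |ρ| := by simpa using hu
  rw [abs_of_pos h2.1] at hu
  exact (h u (hu ▸ h2.1) (hu ▸ h2.2)).hasDerivAt.hasDerivWithinAt

def K0.resAux : meromorphicAlgebra →ₗ[ℂ] ℂ where
  toFun s := residue s.1
  map_add' s t := by
    refine residue_eq_of (s.2.add t.2) ?_
    filter_upwards [residue_spec s.2, residue_spec t.2] with ρ h1 h2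
    rw [← h1.2, ← h2.2, contourIntegral, contourIntegral, contourIntegral, ← mul_add,
      ← circleIntegral.integral_add h1.1 h2.1]
    rfl
  map_smul' a s := by
    refine residue_eq_of (MeromorphicAt.const_smul s.2 a) ?_
    filter_upwards [residue_spec s.2] with ρ h1
    rw [← h1.2, contourIntegral, contourIntegral, RingHom.id_apply, smul_eq_mul,
      mul_left_comm, ← smul_eq_mul a, ← circleIntegral.integral_smul]
    rfl

/-- The residue on germs. The scalar product of `K0` is `⟨s, t⟩ = K0.res (s * t)`. -/
def K0.res : K0 →ₗ[ℂ] ℂ :=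
  Submodule.liftQ (vanishingIdeal.restrictScalars ℂ) K0.resAux (by
    intro s hs
    have h0 : residue (fun _ => (0 : ℂ)) = 0 := residue_eq_of (MeromorphicAt.const 0 0)
      (by simp [contourIntegral, circleIntegral])
    exact (residue_congr s.2 (MeromorphicAt.const 0 0) hs).trans h0)

theorem K0.res_mk (s : ℂ → ℂ) (hs : MeromorphicAt s 0) : K0.res (K0.mk s hs) = residue s := rfl

theorem K0.res_D (s : K0) : K0.res (K0.D s) = 0 := by
  induction s using K0.ind with | _ s hs
  exact residue_deriv hs

theorem K0.res_mul_nondegenerate {s : K0} (h : ∀ t : K0, K0.res (s * t) = 0) : s = 0 := by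
  induction s using K0.ind with | _ s hs
  refine (K0.mk_eq_iff hs (MeromorphicAt.const 0 0)).2 ?_
  rcases hs.eventually_eq_zero_or_eventually_ne_zero with h0 | h0
  · exact h0
  exfalso
  have hm : MeromorphicAt (fun u => (s u)⁻¹ * u⁻¹) 0 := hs.inv.mul (MeromorphicAt.id 0).inv
  have h1 : residue (fun u => s u * ((s u)⁻¹ * u⁻¹)) = 0 := h (K0.mk _ hm)
  have h2 : residue (fun u => s u * ((s u)⁻¹ * u⁻¹)) = 1 := by
    refine residue_eq_of (s := fun u => s u * ((s u)⁻¹ * u⁻¹)) (hs.mul hm) ?_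
    obtain ⟨r, hr, h⟩ := eventually_sphere h0
    filter_upwards [Ioo_mem_nhdsGT hr] with ρ h2
    have : (∮ u in C(0, ρ), s u * ((s u)⁻¹ * u⁻¹)) = ∮ u in C(0, ρ), (u - 0)⁻¹ := by
      refine circleIntegral.integral_congr h2.1.le fun u hu => ?_
      have hu : ‖u‖ = ρ := by simpa using hu
      have := h u (hu ▸ h2.1) (hu ▸ h2.2)
      simp [this]
    rw [contourIntegral, this, circleIntegral.integral_sub_center_inv _ h2.1.ne']
    exact inv_mul_cancel₀ Complex.two_pi_I_ne_zero
  exact zero_ne_one (h1.symm.trans h2)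

/-! ### The theta function -/

/-- The infinite product `(1 - q w)(1 - q² w)(1 - q³ w)⋯`. -/
def qProd (q w : ℂ) : ℂ := ∏' n : ℕ, (1 - q ^ (n + 1) * w)

theorem summable_qProd {q : ℂ} (hq : ‖q‖ < 1) (w : ℂ) :
    Summable fun n : ℕ => ‖-(q ^ (n + 1) * w)‖ := by
  have := ((summable_nat_add_iff 1).mpr
    (summable_geometric_of_lt_one (norm_nonneg q) hq)).mul_right ‖w‖
  simpa using this

theorem multipliable_qProd {q : ℂ} (hq : ‖q‖ < 1) (w : ℂ) :
    Multipliable fun n : ℕ => 1 - q ^ (n + 1) * w := by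
  simpa [sub_eq_add_neg] using multipliable_one_add_of_summable (summable_qProd hq w)

theorem differentiable_qProd {q : ℂ} (hq : ‖q‖ < 1) : Differentiable ℂ (qProd q) := by
  have h : HasProdLocallyUniformlyOn (fun (n : ℕ) (w : ℂ) => 1 + -(q ^ (n + 1) * w))
      (fun w => ∏' n : ℕ, (1 + -(q ^ (n + 1) * w))) Set.univ := by
    refine hasProdLocallyUniformlyOn_of_forall_compact isOpen_univ fun K _ hK => ?_
    obtain ⟨C, hC⟩ := hK.isBounded.exists_norm_le
    refine Summable.hasProdUniformlyOn_nat_one_add (u := fun n => ‖q‖ ^ (n + 1) * C) hK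
      (((summable_nat_add_iff 1).mpr
        (summable_geometric_of_lt_one (norm_nonneg q) hq)).mul_right C)
      (.of_forall fun n w hw => ?_) (fun _ => by fun_prop)
    simpa using mul_le_mul_of_nonneg_left (hC w hw) (by positivity)
  have h2 := h.differentiableOn (.of_forall fun _ => by
    simpa [Finset.prod_fn] using DifferentiableOn.finsetProd (fun _ _ => by fun_prop)) isOpen_univ
  simpa [sub_eq_add_neg, qProd, differentiableOn_univ] using! h2

theorem qProd_ne_zero {q w : ℂ} (hq : ‖q‖ < 1) (h : ∀ n : ℕ, q ^ (n + 1) * w ≠ 1) :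
    qProd q w ≠ 0 := by
  have := tprod_one_add_ne_zero_of_summable (f := fun n : ℕ => -(q ^ (n + 1) * w))
    (fun n => by rw [← sub_eq_add_neg]; exact sub_ne_zero.2 (h n).symm) (summable_qProd hq w)
  simpa [sub_eq_add_neg, qProd] using this

theorem qProd_shift {q : ℂ} (hq : ‖q‖ < 1) (w : ℂ) : qProd q w = (1 - q * w) * qProd q (q * w) := by
  have h := tprod_eq_zero_mul' (f := fun n : ℕ => 1 - q ^ (n + 1) * w) (by
    simpa [pow_succ, mul_assoc] using multipliable_qProd hq (q * w))
  rw [qProd, h, qProd]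
  simp [pow_succ, mul_assoc]

/-- `q = exp(2πiτ)`. -/
def nome (τ : ℂ) : ℂ := Complex.exp (2 * Real.pi * Complex.I * τ)

theorem norm_nome_lt_one {τ : ℂ} (hτ : 0 < τ.im) : ‖nome τ‖ < 1 := by
  simpa [nome] using UpperHalfPlane.norm_exp_two_pi_I_lt_one ⟨τ, hτ⟩

/-- The odd theta function with `θ'(0) = 1`, written as the product
`π⁻¹ sin(πu) ∏ (1 - qⁿe^{2πiu})(1 - qⁿe^{-2πiu})(1 - qⁿ)⁻²` over `n ≥ 1`; its characteristic
properties are proved below. -/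
def theta (τ u : ℂ) : ℂ :=
  Complex.sin (Real.pi * u) / Real.pi *
    (qProd (nome τ) (Complex.exp (2 * Real.pi * Complex.I * u)) *
      qProd (nome τ) (Complex.exp (-(2 * Real.pi * Complex.I * u))) / qProd (nome τ) 1 ^ 2)

/-- The properties that define the odd theta function. -/
structure IsOddTheta (τ : ℂ) (θ : ℂ → ℂ) : Prop where
  differentiable : Differentiable ℂ θ
  odd : ∀ u, θ (-u) = -θ u
  add_one : ∀ u, θ (u + 1) = -θ u
  add_tau : ∀ u, θ (u + τ) =
    -Complex.exp (-(2 * Real.pi * Complex.I * u) - Real.pi * Complex.I * τ) * θ u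
  deriv_zero : deriv θ 0 = 1

theorem isOddTheta_theta {τ : ℂ} (hτ : 0 < τ.im) : IsOddTheta τ (theta τ) := by
  have hq := norm_nome_lt_one hτ
  have hq0 : nome τ ≠ 0 := Complex.exp_ne_zero _
  have h1 : qProd (nome τ) 1 ≠ 0 := qProd_ne_zero hq fun n h => by
    have := congrArg norm h
    rw [mul_one, norm_pow, norm_one] at this
    exact (pow_lt_one₀ (norm_nonneg _) hq (Nat.succ_ne_zero n)).ne this
  have hpi : (Real.pi : ℂ) ≠ 0 := by exact_mod_cast Real.pi_ne_zero
  have hd := differentiable_qProd hq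
  have hd2 : Differentiable ℂ fun u : ℂ =>
      (qProd (nome τ) (Complex.exp (2 * Real.pi * Complex.I * u)) *
      qProd (nome τ) (Complex.exp (-(2 * Real.pi * Complex.I * u))) / qProd (nome τ) 1 ^ 2) := by
    have ha : Differentiable ℂ fun u : ℂ =>
      qProd (nome τ) (Complex.exp (2 * Real.pi * Complex.I * u)) := hd.comp (by fun_prop)
    have hb : Differentiable ℂ fun u : ℂ =>
      qProd (nome τ) (Complex.exp (-(2 * Real.pi * Complex.I * u))) := hd.comp (by fun_prop)
    exact (ha.mul hb).div_const _
  have hd1 : Differentiable ℂ fun u : ℂ => Complex.sin (Real.pi * u) / Real.pi := by fun_prop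
  refine ⟨hd1.mul hd2, fun u => ?_, fun u => ?_, fun u => ?_, ?_⟩
  · simp only [theta, mul_neg, Complex.sin_neg, neg_neg]
    ring
  · have e1 : Complex.exp (2 * Real.pi * Complex.I * (u + 1)) =
        Complex.exp (2 * Real.pi * Complex.I * u) := by
      rw [mul_add, mul_one, Complex.exp_add, Complex.exp_two_pi_mul_I, mul_one]
    simp only [theta, Complex.exp_neg, e1]
    rw [mul_add, mul_one, Complex.sin_add_pi]
    ring
  · set w := Complex.exp (2 * Real.pi * Complex.I * u) with hw
    have hw0 : w ≠ 0 := Complex.exp_ne_zero _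
    have e1 : Complex.exp (2 * Real.pi * Complex.I * (u + τ)) = nome τ * w := by
      rw [mul_add, Complex.exp_add, mul_comm]; rfl
    have e2 : Complex.exp (Real.pi * Complex.I * u) ^ 2 = w := by
      rw [← Complex.exp_nat_mul, hw]; congr 1; push_cast; ring
    have e3 : Complex.exp (Real.pi * Complex.I * τ) ^ 2 = nome τ := by
      rw [← Complex.exp_nat_mul, nome]; congr 1; push_cast; ring
    have s1 := qProd_shift hq w
    have s2 := qProd_shift hq (nome τ * w)⁻¹
    have e4 : nome τ * (nome τ * w)⁻¹ = w⁻¹ := by field_simp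
    rw [e4] at s2
    simp only [theta, Complex.exp_neg, e1, Complex.exp_sub, ← hw]
    rw [s1, s2]
    simp only [Complex.sin]
    have e5 : Complex.exp (Real.pi * (u + τ) * Complex.I) =
      Complex.exp (Real.pi * Complex.I * u) * Complex.exp (Real.pi * Complex.I * τ) := by
      rw [← Complex.exp_add]; congr 1; ring
    have e6 : Complex.exp (Real.pi * u * Complex.I) = Complex.exp (Real.pi * Complex.I * u) := by
      congr 1; ring
    simp only [neg_mul, Complex.exp_neg, e5, e6]
    have a0 : Complex.exp (Real.pi * Complex.I * u) ≠ 0 := Complex.exp_ne_zero _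
    have b0 : Complex.exp (Real.pi * Complex.I * τ) ≠ 0 := Complex.exp_ne_zero _
    rw [← e2, ← e3]
    generalize Complex.exp (Real.pi * Complex.I * u) = a at *
    generalize Complex.exp (Real.pi * Complex.I * τ) = b at *
    field_simp
    ring
  · have h := (hd1 0).hasDerivAt.mul (hd2 0).hasDerivAt
    have h' : HasDerivAt (fun u : ℂ => Complex.sin (Real.pi * u) / Real.pi) 1 0 := by
      have := ((Complex.hasDerivAt_sin (Real.pi * 0)).comp (0 : ℂ)
        ((hasDerivAt_id (0 : ℂ)).const_mul (Real.pi : ℂ))).div_const (Real.pi : ℂ)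
      simpa [hpi, Function.comp_def] using this
    have h2 := h'.mul (hd2 0).hasDerivAt
    have h3 : deriv (theta τ) 0 = _ := h2.deriv
    rw [h3]
    simp
    field_simp

/-! ### The current algebra -/

/-- The underlying space `(sl₂ ⊗ K0) ⊕ ℂ ⊕ ℂ` of the centrally and co-centrally extended current
algebra, `sl₂` being the Lie algebra with basis `h, e, f` and `[h,e] = 2e`, `[h,f] = -2f`,
`[e,f] = h`. The tuple `⟨s, t, r, a, b⟩` is `h ⊗ s + e ⊗ t + f ⊗ r + a c + b d`. -/
@[ext]
structure CurrentAlgebra : Type where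
  h : K0
  e : K0
  f : K0
  c : ℂ
  d : ℂ

namespace CurrentAlgebra

def equivProd : CurrentAlgebra ≃ K0 × K0 × K0 × ℂ × ℂ where
  toFun x := (x.h, x.e, x.f, x.c, x.d)
  invFun p := ⟨p.1, p.2.1, p.2.2.1, p.2.2.2.1, p.2.2.2.2⟩

instance : AddCommGroup CurrentAlgebra := equivProd.addCommGroup
instance : Module ℂ CurrentAlgebra := equivProd.module ℂ

@[simp] theorem h_add (x y : CurrentAlgebra) : (x + y).h = x.h + y.h := rfl
@[simp] theorem e_add (x y : CurrentAlgebra) : (x + y).e = x.e + y.e := rfl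
@[simp] theorem f_add (x y : CurrentAlgebra) : (x + y).f = x.f + y.f := rfl
@[simp] theorem c_add (x y : CurrentAlgebra) : (x + y).c = x.c + y.c := rfl
@[simp] theorem d_add (x y : CurrentAlgebra) : (x + y).d = x.d + y.d := rfl
@[simp] theorem h_zero : (0 : CurrentAlgebra).h = 0 := rfl
@[simp] theorem e_zero : (0 : CurrentAlgebra).e = 0 := rfl
@[simp] theorem f_zero : (0 : CurrentAlgebra).f = 0 := rfl
@[simp] theorem c_zero : (0 : CurrentAlgebra).c = 0 := rfl
@[simp] theorem d_zero : (0 : CurrentAlgebra).d = 0 := rfl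
@[simp] theorem h_smul (a : ℂ) (x : CurrentAlgebra) : (a • x).h = a • x.h := rfl
@[simp] theorem e_smul (a : ℂ) (x : CurrentAlgebra) : (a • x).e = a • x.e := rfl
@[simp] theorem f_smul (a : ℂ) (x : CurrentAlgebra) : (a • x).f = a • x.f := rfl
@[simp] theorem c_smul (a : ℂ) (x : CurrentAlgebra) : (a • x).c = a * x.c := rfl
@[simp] theorem d_smul (a : ℂ) (x : CurrentAlgebra) : (a • x).d = a * x.d := rfl

/-- The bracket: `[x ⊗ s, y ⊗ t] = [x, y] ⊗ s t + (x, y) ⟨s', t⟩ c`, `[d, x ⊗ s] = x ⊗ s'`, and `c`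
is central. Here `(h, h) = 2`, `(e, f) = (f, e) = 1` and `(h, e) = (h, f) = (e, e) = (f, f) = 0`. -/
instance : Bracket CurrentAlgebra CurrentAlgebra where
  bracket x y :=
    { h := x.e * y.f - x.f * y.e + (x.d • K0.D y.h - y.d • K0.D x.h)
      e := (2 : ℂ) • (x.h * y.e - x.e * y.h) + (x.d • K0.D y.e - y.d • K0.D x.e)
      f := (-2 : ℂ) • (x.h * y.f - x.f * y.h) + (x.d • K0.D y.f - y.d • K0.D x.f)
      c := K0.res ((2 : ℂ) • (K0.D x.h * y.h) + K0.D x.e * y.f + K0.D x.f * y.e)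
      d := 0 }

theorem bracket_h (x y : CurrentAlgebra) : ⁅x, y⁆.h =
    x.e * y.f - x.f * y.e + (x.d • K0.D y.h - y.d • K0.D x.h) := rfl
theorem bracket_e (x y : CurrentAlgebra) : ⁅x, y⁆.e =
    (2 : ℂ) • (x.h * y.e - x.e * y.h) + (x.d • K0.D y.e - y.d • K0.D x.e) := rfl
theorem bracket_f (x y : CurrentAlgebra) : ⁅x, y⁆.f =
    (-2 : ℂ) • (x.h * y.f - x.f * y.h) + (x.d • K0.D y.f - y.d • K0.D x.f) := rfl
theorem bracket_c (x y : CurrentAlgebra) : ⁅x, y⁆.c =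
    K0.res ((2 : ℂ) • (K0.D x.h * y.h) + K0.D x.e * y.f + K0.D x.f * y.e) := rfl
theorem bracket_d (x y : CurrentAlgebra) : ⁅x, y⁆.d = 0 := rfl

theorem res_by_parts (s t : K0) : K0.res (K0.D s * t) = -K0.res (s * K0.D t) := by
  have := K0.res_D (s * t)
  rw [K0.D_mul, map_add] at this
  exact eq_neg_of_add_eq_zero_left this

theorem bracket_add_left (x y z : CurrentAlgebra) : ⁅x + y, z⁆ = ⁅x, z⁆ + ⁅y, z⁆ := by
  ext
  · simp only [bracket_h, h_add, e_add, f_add, d_add, map_add, Algebra.smul_def]; ring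
  · simp only [bracket_e, h_add, e_add, d_add, map_add, Algebra.smul_def]; ring
  · simp only [bracket_f, h_add, f_add, d_add, map_add, Algebra.smul_def]; ring
  · simp only [bracket_c, h_add, e_add, f_add, c_add, map_add, map_smul, add_mul, smul_eq_mul]
    ring
  · simp [bracket_d]

theorem bracket_smul_left (a : ℂ) (x y : CurrentAlgebra) : ⁅a • x, y⁆ = a • ⁅x, y⁆ := by
  ext
  · simp only [bracket_h, h_smul, e_smul, f_smul, d_smul, map_smul]
    simp only [map_mul, Algebra.smul_def]; ring
  · simp only [bracket_e, h_smul, e_smul, d_smul, map_smul]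
    simp only [map_mul, Algebra.smul_def]; ring
  · simp only [bracket_f, h_smul, f_smul, d_smul, map_smul]
    simp only [map_mul, Algebra.smul_def]; ring
  · simp only [bracket_c, h_smul, e_smul, f_smul, c_smul, map_add, map_smul, smul_mul_assoc,
      smul_eq_mul]
    ring
  · simp [bracket_d]

theorem bracket_skew (x y : CurrentAlgebra) : ⁅x, y⁆ = -⁅y, x⁆ := by
  refine eq_neg_of_add_eq_zero_left ?_
  ext
  · simp only [bracket_h, h_add, h_zero]; ring
  · simp only [bracket_e, e_add, e_zero, Algebra.smul_def]; ring
  · simp only [bracket_f, f_add, f_zero, Algebra.smul_def]; ring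
  · simp only [bracket_c, c_add, c_zero, map_add, map_smul, smul_eq_mul]
    rw [res_by_parts y.h, res_by_parts y.e, res_by_parts y.f, mul_comm y.h, mul_comm y.e,
      mul_comm y.f]
    ring
  · simp [bracket_d]

theorem bracket_leibniz (x y z : CurrentAlgebra) : ⁅x, ⁅y, z⁆⁆ = ⁅⁅x, y⁆, z⁆ + ⁅y, ⁅x, z⁆⁆ := by
  have hD2 : K0.D (algebraMap ℂ K0 2) = 0 := K0.D_algebraMap 2
  ext
  · simp only [bracket_h, bracket_e, bracket_f, bracket_d, h_add, map_add, map_sub,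
      K0.D_mul, K0.D_algebraMap, Algebra.smul_def, map_zero, map_neg]
    simp only [map_ofNat]
    ring
  · simp only [bracket_h, bracket_e, bracket_d, e_add, map_add, map_sub,
      K0.D_mul, K0.D_algebraMap, Algebra.smul_def, map_zero]
    simp only [map_ofNat]
    ring
  · simp only [bracket_h, bracket_f, bracket_d, f_add, map_add, map_sub,
      K0.D_mul, K0.D_algebraMap, Algebra.smul_def, map_zero, map_neg]
    simp only [map_ofNat]
    ring
  · rw [c_add, bracket_c, bracket_c, bracket_c, ← map_add, ← sub_eq_zero, ← map_sub]
    refine (congrArg K0.res ?_).trans (K0.res_D (y.d • ((2 : ℂ) • (K0.D x.h * z.h) +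
      K0.D x.e * z.f + K0.D x.f * z.e) - x.d • ((2 : ℂ) • (K0.D y.h * z.h) +
      K0.D y.e * z.f + K0.D y.f * z.e)))
    simp only [bracket_h, bracket_e, bracket_f, map_add, map_sub,
      K0.D_mul, K0.D_algebraMap, Algebra.smul_def, map_neg, neg_zero]
    simp only [map_ofNat]
    ring
  · simp [bracket_d]

instance : LieRing CurrentAlgebra where
  add_lie := bracket_add_left
  lie_add x y z := by
    rw [bracket_skew, bracket_add_left, bracket_skew x y, bracket_skew x z, neg_add]
  lie_self x := by
    have h : (2 : ℂ) • ⁅x, x⁆ = 0 := by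
      rw [two_smul]; nth_rewrite 1 [bracket_skew x x]; exact neg_add_cancel _
    exact (smul_eq_zero.1 h).resolve_left two_ne_zero
  leibniz_lie := bracket_leibniz

instance : LieAlgebra ℂ CurrentAlgebra where
  lie_smul a x y := by
    rw [bracket_skew, bracket_smul_left, bracket_skew x y, smul_neg]

/-- The invariant scalar product: `⟨x ⊗ s, y ⊗ t⟩ = (x, y) ⟨s, t⟩`, `⟨c, d⟩ = 1`, the other
pairings of `c`, `d` and the `x ⊗ s` being zero. -/
def form : LinearMap.BilinForm ℂ CurrentAlgebra :=
  LinearMap.mk₂ ℂ (fun x y => K0.res ((2 : ℂ) • (x.h * y.h) + x.e * y.f + x.f * y.e) +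
      x.c * y.d + x.d * y.c)
    (fun x y z => by simp [add_mul]; ring) (fun a x y => by simp [mul_add]; ring)
    (fun x y z => by simp [mul_add]; ring) (fun a x y => by simp [mul_add]; ring)

theorem form_apply (x y : CurrentAlgebra) : form x y =
    K0.res ((2 : ℂ) • (x.h * y.h) + x.e * y.f + x.f * y.e) + x.c * y.d + x.d * y.c := rfl

theorem form_symm (x y : CurrentAlgebra) : form x y = form y x := by
  simp only [form_apply, mul_comm, map_add, add_comm, add_left_comm]

theorem form_invariant (x y z : CurrentAlgebra) : form ⁅x, y⁆ z = form x ⁅y, z⁆ := by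
  have h := K0.res_D (z.d • ((2 : ℂ) • (x.h * y.h) + x.e * y.f + x.f * y.e) -
    y.d • ((2 : ℂ) • (x.h * z.h) + x.e * z.f + x.f * z.e))
  rw [form_apply, form_apply, bracket_c, bracket_c, bracket_d, bracket_d, zero_mul, mul_zero,
    add_zero, add_zero, ← sub_eq_zero, ← h, mul_comm _ z.d, ← smul_eq_mul z.d, ← smul_eq_mul x.d,
    ← map_smul, ← map_smul, ← map_add, ← map_add, ← map_sub]
  congr 1
  simp only [bracket_h, bracket_e, bracket_f, map_add, map_sub,
    K0.D_mul, K0.D_algebraMap, Algebra.smul_def, map_neg]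
  simp only [map_ofNat]
  ring

theorem form_nondegenerate {x : CurrentAlgebra} (hx : ∀ y, form x y = 0) : x = 0 := by
  ext
  · refine K0.res_mul_nondegenerate fun t => ?_
    simpa [form_apply] using hx ⟨t, 0, 0, 0, 0⟩
  · refine K0.res_mul_nondegenerate fun t => ?_
    simpa [form_apply] using hx ⟨0, 0, t, 0, 0⟩
  · refine K0.res_mul_nondegenerate fun t => ?_
    simpa [form_apply] using hx ⟨0, t, 0, 0, 0⟩
  · simpa [form_apply] using hx ⟨0, 0, 0, 0, 1⟩
  · simpa [form_apply] using hx ⟨0, 0, 0, 1, 0⟩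

/-- The element `h ⊗ s`. -/
def hh (s : K0) : CurrentAlgebra := ⟨s, 0, 0, 0, 0⟩
/-- The element `e ⊗ s`. -/
def ee (s : K0) : CurrentAlgebra := ⟨0, s, 0, 0, 0⟩
/-- The element `f ⊗ s`. -/
def ff (s : K0) : CurrentAlgebra := ⟨0, 0, s, 0, 0⟩
/-- The central element. -/
def cc : CurrentAlgebra := ⟨0, 0, 0, 1, 0⟩
/-- The co-central element. -/
def dd : CurrentAlgebra := ⟨0, 0, 0, 0, 1⟩

end CurrentAlgebra

/-! ### Elliptic bases -/

/-- The period lattice `ℤ + τℤ`. -/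
def lattice (τ : ℂ) : Set ℂ := {w | ∃ m n : ℤ, w = m + n * τ}

/-- `θ(u+λ) / (θ(u) θ(λ))` for `λ ≠ 0`, and `θ'(u) / θ(u)` for `λ = 0`. -/
def green (τ lam u : ℂ) : ℂ :=
  if lam = 0 then deriv (theta τ) u / theta τ u
  else theta τ (u + lam) / (theta τ u * theta τ lam)

theorem meromorphicAt_green (τ : UpperHalfPlane) (lam : ℂ) : MeromorphicAt (green τ lam) 0 := by
  have hd := (isOddTheta_theta τ.im_pos).differentiable
  have h0 : MeromorphicAt (theta τ) 0 := (hd.analyticAt 0).meromorphicAt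
  by_cases h : lam = 0
  · have : green τ lam = fun u => deriv (theta τ) u / theta τ u := by
      ext u; simp [green, h]
    rw [this]
    exact h0.deriv.div h0
  · have : green τ lam = fun u => theta τ (u + lam) / (theta τ u * theta τ lam) := by
      ext u; simp [green, h]
    rw [this]
    have h1 : Differentiable ℂ fun u => theta τ (u + lam) := hd.comp (by fun_prop)
    exact (h1.analyticAt 0).meromorphicAt.div (h0.mul (MeromorphicAt.const _ 0))

/-- The germ of `green τ lam`. -/
def greenGerm (τ : UpperHalfPlane) (lam : ℂ) : K0 := K0.mk (green τ lam) (meromorphicAt_green τ lam)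

/-- The germ of the coordinate function `u`. -/
def coord : K0 := K0.mk (fun u => u) (MeromorphicAt.id 0)

/-- The functions with upper index: for `n ≥ 0`, the one with index `n` is
`(1/n!) (θ(u+λ) / (θ(u)θ(λ)))⁽ⁿ⁾` (for `λ = 0`: `(1/n!) (θ'(u)/θ(u))⁽ⁿ⁾`), and the one with index
`-n-1` is `uⁿ`. -/
def epsUp (τ : UpperHalfPlane) (lam : ℂ) : ℤ → K0
  | Int.ofNat n => ((n.factorial : ℂ)⁻¹) • (K0.D ^ n) (greenGerm τ lam)
  | Int.negSucc n => coord ^ n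

/-- The functions with lower index: for `n ≥ 0`, the one with index `n` is `(-u)ⁿ`, and the one
with index `-n-1` is `((-1)ⁿ/n!) (θ(u-λ) / (θ(u)θ(-λ)))⁽ⁿ⁾` (for `λ = 0`:
`((-1)ⁿ/n!) (θ'(u)/θ(u))⁽ⁿ⁾`). -/
def epsDown (τ : UpperHalfPlane) (lam : ℂ) : ℤ → K0
  | Int.ofNat n => (-coord) ^ n
  | Int.negSucc n => ((-1 : ℂ) ^ n * (n.factorial : ℂ)⁻¹) • (K0.D ^ n) (greenGerm τ (-lam))

/-! ### Completed tensor powers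

Let `B` be a nondegenerate invariant symmetric form on a Lie algebra `g`. A tensor
`a₁ ⊗ ⋯ ⊗ aₙ` is identified with the functional `(x₁, …, xₙ) ↦ ∏ B(aᵢ, xᵢ)`. Infinite sums of
tensors are taken pointwise on test elements, that is, in the product topology of
`(Fin n → g) → ℂ`. -/

section Tensor

variable {g : Type*} [LieRing g] [LieAlgebra ℂ g] (B : LinearMap.BilinForm ℂ g)

/-- The functional of `a₁ ⊗ ⋯ ⊗ aₙ`. -/
def pureTensor {n : ℕ} (a : Fin n → g) : (Fin n → g) → ℂ := fun x => ∏ i, B (a i) (x i)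

/-- The completed `n`-th tensor power of `g`: the functionals of `n` arguments all of whose partial
actions (on all arguments but one) are given by elements of `g`. They are multilinear. -/
def completedTensor (n : ℕ) : Submodule ℂ ((Fin n → g) → ℂ) where
  carrier := {T | ∀ i x, ∃ a : g, ∀ y, T (Function.update x i y) = B a y}
  add_mem' {S T} hS hT i x := by
    obtain ⟨a, ha⟩ := hS i x
    obtain ⟨b, hb⟩ := hT i x
    exact ⟨a + b, fun y => by simp [ha, hb]⟩
  zero_mem' i x := ⟨0, fun y => by simp⟩
  smul_mem' r T hT i x := by
    obtain ⟨a, ha⟩ := hT i x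
    exact ⟨r • a, fun y => by simp [ha]⟩

/-- The element `a` of `g` with `B(a, y) = l(y)` for all `y`, where there is one (it is unique since
`B` is nondegenerate). -/
def representative (l : g → ℂ) : g := Classical.epsilon fun a => ∀ y, B a y = l y

/-- `id ⊗ ⋯ ⊗ A ⊗ ⋯ ⊗ id` on the completed tensor power, `A` acting in the position `i`. -/
def mapAt {n : ℕ} (i : Fin n) (A : g → g) (T : (Fin n → g) → ℂ) : (Fin n → g) → ℂ :=
  fun x => B (A (representative B fun y => T (Function.update x i y))) (x i)

/-- The adjoint action `[a ⊗ 1 ⊗ ⋯ ⊗ 1 + ⋯ + 1 ⊗ ⋯ ⊗ 1 ⊗ a, T]`. -/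
def adjointAction {n : ℕ} (a : g) (T : (Fin n → g) → ℂ) : (Fin n → g) → ℂ :=
  ∑ i, mapAt B i (fun b => ⁅a, b⁆) T

/-- `(δ ⊗ id ⊗ ⋯ ⊗ id) T` for `δ` with values in the completed tensor square. -/
def mapFirst (δ : g → (Fin 2 → g) → ℂ) {n : ℕ} (T : (Fin (n + 1) → g) → ℂ) :
    (Fin (n + 2) → g) → ℂ :=
  fun x => δ (representative B fun y => T (Fin.cons y fun j => x j.succ.succ)) ![x 0, x 1]

/-- The tensor `T` with `a` inserted in the position `i`: `a_{i} T_{jk}` for `{i, j, k} = {1, 2, 3}`,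
`j < k` (the positions being numbered from `0`). -/
def insertAt (i : Fin 3) (a : g) (T : (Fin 2 → g) → ℂ) : (Fin 3 → g) → ℂ :=
  fun x => B a (x i) * T (i.removeNth x)

/-- The tensor Casimir element, that is, the canonical element `∑ xᵢ ⊗ xⁱ` of the form
`B`. -/
def casimir : (Fin 2 → g) → ℂ := fun x => B (x 0) (x 1)

end Tensor

section Skew

variable {g : Type*}

/-- The tensor with its two factors interchanged. -/
def swapFactors (T : (Fin 2 → g) → ℂ) : (Fin 2 → g) → ℂ := fun x => T ![x 1, x 0]

/-- Skew-symmetric tensors. -/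
def IsSkew {n : ℕ} (T : (Fin n → g) → ℂ) : Prop :=
  ∀ (σ : Equiv.Perm (Fin n)) (x : Fin n → g), T (x ∘ σ) = ((Equiv.Perm.sign σ : ℤ) : ℂ) * T x

/-- The alternation `∑ sgn(σ) σ(T)` over all permutations of the factors, without a
normalizing coefficient. -/
def alternation {n : ℕ} (T : (Fin n → g) → ℂ) : (Fin n → g) → ℂ :=
  fun x => ∑ σ : Equiv.Perm (Fin n), ((Equiv.Perm.sign σ : ℤ) : ℂ) * T (x ∘ σ)

end Skew

/-- A quasi-Lie bialgebra structure on the Lie algebra `g`: a linear co-bracket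
`δ : g → g ∧ g` and an element `φ` of `g ∧ g ∧ g` (completed exterior powers) such that `δ` is a
1-cocycle, the co-Jacobi identity holds up to the action on `φ`, and `φ` is compatible with
`δ`. -/
structure IsQuasiLieBialgebra {g : Type*} [LieRing g] [LieAlgebra ℂ g]
    (B : LinearMap.BilinForm ℂ g) (δ : g → (Fin 2 → g) → ℂ) (φ : (Fin 3 → g) → ℂ) : Prop where
  map_add : ∀ a b, δ (a + b) = δ a + δ b
  map_smul : ∀ (r : ℂ) a, δ (r • a) = r • δ a
  cobracket_mem : ∀ a, δ a ∈ completedTensor B 2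
  cobracket_skew : ∀ a, IsSkew (δ a)
  assoc_mem : φ ∈ completedTensor B 3
  assoc_skew : IsSkew φ
  cocycle : ∀ a b, δ ⁅a, b⁆ = adjointAction B a (δ b) - adjointAction B b (δ a)
  coJacobi : ∀ a, (1 / 2 : ℂ) • alternation (mapFirst B δ (δ a)) = adjointAction B a φ
  compatibility : alternation (mapFirst B δ φ) = 0

/-! ### The universal r-matrix -/

open CurrentAlgebra

/-- The index set of the terms of the universal r-matrix. -/
inductive RIndex : Type
  | hTerm (n : ℕ)
  | fTerm (n : ℕ)
  | eTerm (n : ℕ)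
  | cTerm

/-- The first factors of the terms of the universal r-matrix; `eTerm n` has the index `-n-1`. -/
def legLeft (τ : UpperHalfPlane) (lam : ℂ) : RIndex → CurrentAlgebra
  | .hTerm n => (1 / 2 : ℂ) • hh (epsUp τ 0 n)
  | .fTerm n => ff (epsUp τ lam n)
  | .eTerm n => ee (epsDown τ lam (-(n : ℤ) - 1))
  | .cTerm => cc

/-- The second factors of the terms of the universal r-matrix. -/
def legRight (τ : UpperHalfPlane) (lam : ℂ) : RIndex → CurrentAlgebra
  | .hTerm n => hh (epsDown τ 0 n)
  | .fTerm n => ee (epsDown τ lam n)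
  | .eTerm n => ff (epsUp τ lam (-(n : ℤ) - 1))
  | .cTerm => dd

/-- The terms of the universal r-matrix. -/
def rTerm (τ : UpperHalfPlane) (lam : ℂ) (i : RIndex) : (Fin 2 → CurrentAlgebra) → ℂ :=
  pureTensor form ![legLeft τ lam i, legRight τ lam i]

/-- The universal r-matrix `½ ∑_{n≥0} h[ε^{n;0}] ⊗ h[ε_{n;0}] + ∑_{n≥0} f[ε^{n;λ}] ⊗ e[ε_{n;λ}]
+ ∑_{n<0} e[ε_{n;λ}] ⊗ f[ε^{n;λ}] + c ⊗ d`. -/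
def rMatrix (τ : UpperHalfPlane) (lam : ℂ) : (Fin 2 → CurrentAlgebra) → ℂ := ∑' i, rTerm τ lam i

/-- The derivative of the universal r-matrix with respect to `λ`. -/
def rMatrixDeriv (τ : UpperHalfPlane) (lam : ℂ) : (Fin 2 → CurrentAlgebra) → ℂ :=
  fun x => deriv (fun l => rMatrix τ l x) lam

/-- The terms `[aᵢ, aⱼ] ⊗ bᵢ ⊗ bⱼ` of `[r₁₂, r₁₃]`, where `r = ∑ aᵢ ⊗ bᵢ`. -/
def term1213 (τ : UpperHalfPlane) (lam : ℂ) (p : RIndex × RIndex) :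
    (Fin 3 → CurrentAlgebra) → ℂ :=
  pureTensor form ![⁅legLeft τ lam p.1, legLeft τ lam p.2⁆, legRight τ lam p.1, legRight τ lam p.2]

/-- The terms `aᵢ ⊗ [bᵢ, aⱼ] ⊗ bⱼ` of `[r₁₂, r₂₃]`. -/
def term1223 (τ : UpperHalfPlane) (lam : ℂ) (p : RIndex × RIndex) :
    (Fin 3 → CurrentAlgebra) → ℂ :=
  pureTensor form ![legLeft τ lam p.1, ⁅legRight τ lam p.1, legLeft τ lam p.2⁆, legRight τ lam p.2]

/-- The terms `aᵢ ⊗ aⱼ ⊗ [bᵢ, bⱼ]` of `[r₁₃, r₂₃]`. -/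
def term1323 (τ : UpperHalfPlane) (lam : ℂ) (p : RIndex × RIndex) :
    (Fin 3 → CurrentAlgebra) → ℂ :=
  pureTensor form ![legLeft τ lam p.1, legLeft τ lam p.2, ⁅legRight τ lam p.1, legRight τ lam p.2⁆]

/-- `[r₁₂, r₁₃] + [r₁₂, r₂₃] + [r₁₃, r₂₃]`. -/
def yangBaxter (τ : UpperHalfPlane) (lam : ℂ) : (Fin 3 → CurrentAlgebra) → ℂ :=
  (∑' p, term1213 τ lam p) + (∑' p, term1223 τ lam p) + (∑' p, term1323 τ lam p)

/-- The terms `[x, aᵢ] ⊗ bᵢ + aᵢ ⊗ [x, bᵢ]` of `[x ⊗ 1 + 1 ⊗ x, r]`. -/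
def cobracketTerm (τ : UpperHalfPlane) (lam : ℂ) (x : CurrentAlgebra) (i : RIndex) :
    (Fin 2 → CurrentAlgebra) → ℂ :=
  pureTensor form ![⁅x, legLeft τ lam i⁆, legRight τ lam i] +
    pureTensor form ![legLeft τ lam i, ⁅x, legRight τ lam i⁆]

/-- The co-bracket `δ x = [x ⊗ 1 + 1 ⊗ x, r]`. -/
def cobracket (τ : UpperHalfPlane) (lam : ℂ) (x : CurrentAlgebra) :
    (Fin 2 → CurrentAlgebra) → ℂ :=
  ∑' i, cobracketTerm τ lam x i

end EllipticCurrent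

end

open EllipticCurrent EllipticCurrent.CurrentAlgebra

/-!
The series of the universal r-matrix is, as a functional, `(x, y) ↦ ⟨x, Q y⟩`, where the
operator `Q` (`polarPart`) projects the current algebra onto a complement of the subalgebra
spanned by `d` and the `x ⊗ s` with `s` regular at the origin. On each of the components `h`, `e`, `f`
it is the operator `s ↦ ∑ₙ Res((-u)ⁿ s) g⁽ⁿ⁾ / n!` (`proj`) for the appropriate quotient `g` of theta
functions. Since `g` has a simple pole of residue `1`, its derivatives provide all principal
parts, and `s - proj g s` is regular. On given test elements every series of the theorem has
finitely many nonzero terms (`isTensorExpansion_polarPart`), because a power of `u` of large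
order kills a given pole.

The substitution `u ↦ -u` shows that the spans of the derivatives of the functions with the
parameters `λ` and `-λ` are orthogonal (`res_green_mul_green`), while regular germs are
orthogonal to regular germs. This gives the duality of the bases, the relation `Q + Q* = 1`,
that is `r₁₂ + r₂₁ = Ω`, and the isotropy of the images of `Q` and `1 - Q`
(`isIsotropicSplitting_polarPart`). For every such isotropic splitting of a Lie algebra whose
part `1 - Q` is a subalgebra, the left hand side of the Yang-Baxter equation is
`⟨Q x, [Q y, Q z]⟩`, the co-bracket is the commutator of `ad w` with `Q`, and the axioms of a quasi-Lie
bialgebra follow from invariance and the Jacobi identity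
(`IsIsotropicSplitting.isQuasiLieBialgebra`).

Elliptic functions enter only in the evaluation of `⟨Q x, [Q y, Q z]⟩`, a sum of residues of
products `A B C` with factors in the images of the three projections. The translation
`u ↦ u + τ` adds `-2πi Res a` to `A = proj g₀ a` and multiplies `B` and `C` by inverse constants, and it
adds a multiple of `B` to the derivative of `B` with respect to its parameter. Hence a
combination of `A B C` and of this derivative times `C` is elliptic, and the residue theorem
(`residue_eq_zero_of_elliptic`), which is derived from Liouville's theorem, yields the right
hand side (`res_proj_mul_proj_mul_proj`, `form_polarPart_lie`).
-/

noncomputable section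
namespace EllipticCurrent
open Filter Topology

/-! ### Germs, regular germs and moments -/

theorem K0.mk_add {s t : ℂ → ℂ} (hs : MeromorphicAt s 0) (ht : MeromorphicAt t 0) :
    K0.mk (fun u => s u + t u) (hs.add ht) = K0.mk s hs + K0.mk t ht := rfl

theorem K0.mk_mul {s t : ℂ → ℂ} (hs : MeromorphicAt s 0) (ht : MeromorphicAt t 0) :
    K0.mk (fun u => s u * t u) (hs.mul ht) = K0.mk s hs * K0.mk t ht := rfl

theorem K0.mk_smul (a : ℂ) {s : ℂ → ℂ} (hs : MeromorphicAt s 0) :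
    K0.mk (fun u => a * s u) ((MeromorphicAt.const a 0).mul hs) = a • K0.mk s hs := rfl

theorem K0.mk_const (a : ℂ) : K0.mk (fun _ => a) (MeromorphicAt.const a 0) = algebraMap ℂ K0 a :=
  rfl

theorem K0.mk_congr {s t : ℂ → ℂ} (hs : MeromorphicAt s 0) (ht : MeromorphicAt t 0) (h : s = t) :
    K0.mk s hs = K0.mk t ht := by subst h; rfl

/-- The germ of `u⁻¹`. -/
def coordInv : K0 := K0.mk (fun u => u⁻¹) (MeromorphicAt.id 0).inv

theorem coord_mul_coordInv : coord * coordInv = 1 := by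
  rw [coord, coordInv, ← K0.mk_mul, ← map_one (algebraMap ℂ K0), ← K0.mk_const, K0.mk_eq_iff]
  filter_upwards [self_mem_nhdsWithin] with u hu
  exact mul_inv_cancel₀ hu

/-- The germs of functions that are holomorphic at the origin. -/
def regular : Subalgebra ℂ K0 where
  carrier := {s | ∃ (o : ℂ → ℂ) (ho : AnalyticAt ℂ o 0), s = K0.mk o ho.meromorphicAt}
  mul_mem' := by
    rintro _ _ ⟨o, ho, rfl⟩ ⟨o', ho', rfl⟩
    exact ⟨_, ho.mul ho', rfl⟩
  add_mem' := by
    rintro _ _ ⟨o, ho, rfl⟩ ⟨o', ho', rfl⟩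
    exact ⟨_, ho.add ho', rfl⟩
  algebraMap_mem' a := ⟨fun _ => a, analyticAt_const, rfl⟩

theorem coord_mem_regular : coord ∈ regular := ⟨_, analyticAt_id, rfl⟩

theorem D_mem_regular {s : K0} (hs : s ∈ regular) : K0.D s ∈ regular := by
  obtain ⟨o, ho, rfl⟩ := hs
  exact ⟨_, ho.deriv, rfl⟩

theorem D_pow_mem_regular {s : K0} (hs : s ∈ regular) (n : ℕ) : (K0.D ^ n) s ∈ regular := by
  induction n with
  | zero => simpa using hs
  | succ n ih => rw [pow_succ']; exact D_mem_regular ih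

/-- Cauchy's integral formula at the centre of the circle. -/
theorem res_mul_coordInv {o : ℂ → ℂ} (ho : AnalyticAt ℂ o 0) :
    K0.res (K0.mk o ho.meromorphicAt * coordInv) = o 0 := by
  rw [coordInv, ← K0.mk_mul, K0.res_mk]
  refine residue_eq_of (ho.meromorphicAt.mul (MeromorphicAt.id 0).inv) ?_
  obtain ⟨r, hr, h⟩ := Metric.eventually_nhds_iff_ball.1 ho.eventually_analyticAt
  filter_upwards [Ioo_mem_nhdsGT hr] with ρ hρ
  have hd : DiffContOnCl ℂ o (Metric.ball 0 ρ) := by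
    refine DifferentiableOn.diffContOnCl fun u hu => ?_
    have := Metric.closure_ball_subset_closedBall hu
    exact (h u (Metric.closedBall_subset_ball hρ.2 this)).differentiableAt.differentiableWithinAt
  have := hd.circleIntegral_sub_inv_smul (Metric.mem_ball_self hρ.1)
  simp only [sub_zero, smul_eq_mul] at this
  change (2 * Real.pi * Complex.I)⁻¹ * (∮ u in C(0, ρ), o u * u⁻¹) = o 0
  rw [circleIntegral.integral_congr hρ.1.le fun u _ => mul_comm (o u) u⁻¹, this, ← mul_assoc,
    inv_mul_cancel₀ Complex.two_pi_I_ne_zero, one_mul]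

theorem res_regular {s : K0} (hs : s ∈ regular) : K0.res s = 0 := by
  obtain ⟨o, ho, rfl⟩ := hs
  have h := res_mul_coordInv (analyticAt_id.mul ho)
  have e : K0.mk (id * o) (analyticAt_id.mul ho).meromorphicAt
      = coord * K0.mk o ho.meromorphicAt := rfl
  rw [e, mul_right_comm, coord_mul_coordInv, one_mul] at h
  simpa using h

/-- An analytic germ is divisible by the coordinate when its value, which is a residue,
vanishes. -/
theorem mul_coordInv_mem_regular {s : K0} (hs : s ∈ regular) (h : K0.res (s * coordInv) = 0) :
    s * coordInv ∈ regular := by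
  obtain ⟨o, ho, rfl⟩ := hs
  rw [res_mul_coordInv ho] at h
  obtain ⟨p, hp⟩ := ho
  have hd : AnalyticAt ℂ (dslope o 0) 0 := ⟨_, hp.has_fpower_series_dslope_fslope⟩
  refine ⟨_, hd, ?_⟩
  rw [coordInv, ← K0.mk_mul, K0.mk_eq_iff]
  filter_upwards [self_mem_nhdsWithin] with u hu
  have hu : u ≠ 0 := hu
  rw [dslope_of_ne _ hu, slope_def_field, h, sub_zero, sub_zero, div_eq_mul_inv]

theorem exists_coord_pow_mul_mem (s : K0) : ∃ N : ℕ, ∀ n ≥ N, coord ^ n * s ∈ regular := by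
  induction s using K0.ind with | _ s hs
  obtain ⟨N, hN⟩ := id hs
  have h1 : coord ^ N * K0.mk s hs ∈ regular := by
    refine ⟨_, hN, ?_⟩
    have : coord ^ N = K0.mk (fun u => u ^ N) (MeromorphicAt.pow (MeromorphicAt.id 0) N) := rfl
    rw [this, ← K0.mk_mul]
    exact K0.mk_congr _ _ (by ext u; simp)
  refine ⟨N, fun n hn => ?_⟩
  obtain ⟨k, rfl⟩ := Nat.exists_eq_add_of_le' hn
  rw [pow_add, mul_assoc]
  exact mul_mem (pow_mem coord_mem_regular k) h1

theorem res_neg_coord_pow_mul (n : ℕ) (s : K0) :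
    K0.res ((-coord) ^ n * s) = (-1) ^ n * K0.res (coord ^ n * s) := by
  have : (-coord) ^ n * s = ((-1 : ℂ) ^ n) • (coord ^ n * s) := by
    rw [neg_pow, Algebra.smul_def, map_pow, map_neg, map_one, mul_assoc]
  rw [this, map_smul, smul_eq_mul]

/-- A germ all of whose residues against the powers of the coordinate vanish is regular. -/
theorem mem_regular_of_moments {s : K0} (h : ∀ n : ℕ, K0.res ((-coord) ^ n * s) = 0) :
    s ∈ regular := by
  have h' : ∀ n : ℕ, K0.res (coord ^ n * s) = 0 := fun n => by
    have := h n
    rw [res_neg_coord_pow_mul] at this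
    exact (mul_eq_zero.1 this).resolve_left (pow_ne_zero _ (by norm_num))
  obtain ⟨N, hN⟩ := exists_coord_pow_mul_mem s
  have key : ∀ k : ℕ, coord ^ k * s ∈ regular → s ∈ regular := by
    intro k
    induction k with
    | zero => simp
    | succ k ih =>
      intro hk
      have e : coord ^ (k + 1) * s * coordInv = coord ^ k * s := by
        rw [pow_succ, mul_right_comm, mul_assoc (coord ^ k), coord_mul_coordInv, mul_one]
      have := mul_coordInv_mem_regular hk (by rw [e]; exact h' k)
      exact ih (e ▸ this)
  exact key N (hN N le_rfl)

/-- The coefficients of the principal part: the `n`-th moment of `s` is `Res (-u)ⁿ s(u) du`. Only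
finitely many of them are nonzero. -/
def moments : K0 →ₗ[ℂ] (ℕ →₀ ℂ) where
  toFun s := Finsupp.ofSupportFinite (fun n => K0.res ((-coord) ^ n * s)) (by
    obtain ⟨N, hN⟩ := exists_coord_pow_mul_mem s
    refine (Set.finite_Iio N).subset fun n hn => ?_
    by_contra hlt
    exact hn (by
      simp only [res_neg_coord_pow_mul, res_regular (hN n (not_lt.1 hlt)), mul_zero]))
  map_add' s t := by
    ext n
    change K0.res (_ * (s + t)) = K0.res (_ * s) + K0.res (_ * t)
    rw [mul_add, map_add]
  map_smul' a s := by
    ext n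
    change K0.res (_ * (a • s)) = a * K0.res (_ * s)
    rw [mul_smul_comm, map_smul, smul_eq_mul]

theorem moments_apply (s : K0) (n : ℕ) : moments s n = K0.res ((-coord) ^ n * s) := rfl

theorem moments_zero_apply (s : K0) : moments s 0 = K0.res s := by simp [moments_apply]

theorem mem_regular_iff {s : K0} : s ∈ regular ↔ moments s = 0 := by
  refine ⟨fun h => ?_, fun h => mem_regular_of_moments fun n => ?_⟩
  · ext n
    exact res_regular (mul_mem (pow_mem (neg_mem coord_mem_regular) n) h)
  · rw [← moments_apply, h]; rfl

theorem res_mul_D_pow (n : ℕ) (s t : K0) :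
    K0.res (s * (K0.D ^ n) t) = (-1) ^ n * K0.res ((K0.D ^ n) s * t) := by
  induction n generalizing s with
  | zero => simp
  | succ n ih =>
    rw [pow_succ' K0.D n, Module.End.mul_apply, ← neg_inj, ← CurrentAlgebra.res_by_parts, ih,
      ← pow_succ' K0.D n, pow_succ K0.D n, Module.End.mul_apply]
    ring

theorem D_coord : K0.D coord = 1 := by
  rw [coord, K0.D_mk, ← map_one (algebraMap ℂ K0), ← K0.mk_const]
  exact K0.mk_congr _ _ (by ext u; exact deriv_id u)

theorem D_neg_coord_pow (m : ℕ) :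
    K0.D ((-coord) ^ (m + 1)) = (-(m + 1 : ℂ)) • (-coord) ^ m := by
  induction m with
  | zero => simp [D_coord]
  | succ m ih =>
    rw [pow_succ, K0.D_mul, ih, map_neg, D_coord]
    simp only [Algebra.smul_def]
    push_cast
    ring

/-- The germs with a simple pole at the origin, of residue `1`. -/
structure IsSimplePole (g : K0) : Prop where
  coord_mul_mem : coord * g ∈ regular
  res_eq_one : K0.res g = 1

theorem isSimplePole_coordInv : IsSimplePole coordInv := by
  refine ⟨by rw [coord_mul_coordInv]; exact one_mem _, ?_⟩
  have := res_mul_coordInv (o := fun _ => 1) analyticAt_const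
  rwa [K0.mk_const, map_one, one_mul] at this

/-- The derivatives of a simple pole, divided by factorials, form the basis of principal parts that
is dual to the powers of `-u`. -/
theorem IsSimplePole.res_pow_mul_D_pow {g : K0} (hg : IsSimplePole g) (m n : ℕ) :
    K0.res ((-coord) ^ m * (K0.D ^ n) g) = if m = n then (n.factorial : ℂ) else 0 := by
  induction n generalizing m with
  | zero =>
    cases m with
    | zero => simp [hg.res_eq_one]
    | succ m =>
      rw [if_neg (Nat.succ_ne_zero m)]
      refine res_regular ?_
      rw [pow_succ, mul_assoc, pow_zero, Module.End.one_apply, neg_mul]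
      exact mul_mem (pow_mem (neg_mem coord_mem_regular) m) (neg_mem hg.coord_mul_mem)
  | succ n ih =>
    rw [pow_succ' K0.D n, Module.End.mul_apply, ← neg_inj, ← CurrentAlgebra.res_by_parts]
    cases m with
    | zero =>
      have : K0.D 1 = 0 := by simpa using K0.D_algebraMap 1
      simp [this]
    | succ m =>
      rw [D_neg_coord_pow, smul_mul_assoc, map_smul, ih]
      by_cases h : m = n
      · subst h
        simp [Nat.factorial_succ]
        ring
      · simp [h]

/-- The projection `s ↦ ∑ₙ Res((-u)ⁿ s) g⁽ⁿ⁾ / n!`. When `g` has a simple pole with residue `1`,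
its kernel consists of the regular germs and its image is spanned by the derivatives of `g`. -/
def proj (g : K0) : K0 →ₗ[ℂ] K0 :=
  Finsupp.linearCombination ℂ (fun n : ℕ => ((n.factorial : ℂ)⁻¹) • (K0.D ^ n) g) ∘ₗ moments

theorem proj_apply (g s : K0) :
    proj g s = (moments s).sum fun n a => a • ((n.factorial : ℂ)⁻¹) • (K0.D ^ n) g := rfl

theorem proj_of_mem_regular (g : K0) {s : K0} (hs : s ∈ regular) : proj g s = 0 := by
  rw [proj, LinearMap.comp_apply, mem_regular_iff.1 hs, map_zero]

theorem proj_mem_regular {g : K0} (hg : g ∈ regular) (s : K0) : proj g s ∈ regular :=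
  sum_mem fun n _ => Subalgebra.smul_mem _ (Subalgebra.smul_mem _ (D_pow_mem_regular hg n) _) _

theorem IsSimplePole.sub_proj_mem {g : K0} (hg : IsSimplePole g) (s : K0) :
    s - proj g s ∈ regular := by
  rw [mem_regular_iff, map_sub, sub_eq_zero]
  ext m
  rw [moments_apply (proj g s), proj_apply, Finsupp.sum, Finset.mul_sum, map_sum]
  simp only [mul_smul_comm, map_smul, hg.res_pow_mul_D_pow, smul_eq_mul]
  rw [Finset.sum_eq_single m]
  · simp [Nat.factorial_ne_zero]
  · intro n _ hn
    simp [Ne.symm hn]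
  · intro h
    simp [Finsupp.notMem_support_iff.1 h]

theorem res_proj_mul (g s t : K0) : K0.res (proj g s * t) =
    (moments s).sum fun n a => a * ((n.factorial : ℂ)⁻¹ * K0.res ((K0.D ^ n) g * t)) := by
  rw [proj_apply, Finsupp.sum, Finset.sum_mul, map_sum]
  simp [Finsupp.sum]

/-- If the spans of the derivatives of `g` and `g'` are orthogonal to each other, the projections
onto the principal parts and onto the regular parts are adjoint to each other. -/
theorem IsSimplePole.res_proj_add {g g' : K0} (hg : IsSimplePole g) (hg' : IsSimplePole g')
    (h : ∀ n m : ℕ, K0.res ((K0.D ^ n) g * (K0.D ^ m) g') = 0) (s t : K0) :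
    K0.res (proj g s * proj g' t) = 0 ∧
      K0.res (proj g s * t) + K0.res (s * proj g' t) = K0.res (s * t) := by
  have h0 : K0.res (proj g s * proj g' t) = 0 := by
    rw [res_proj_mul]
    refine Finset.sum_eq_zero fun n _ => ?_
    have : K0.res ((K0.D ^ n) g * proj g' t) = 0 := by
      rw [mul_comm, res_proj_mul]
      refine Finset.sum_eq_zero fun m _ => ?_
      beta_reduce
      rw [mul_comm ((K0.D ^ m) g'), h, mul_zero, mul_zero]
    beta_reduce
    rw [this, mul_zero, mul_zero]
  refine ⟨h0, ?_⟩
  have h1 := res_regular (mul_mem (hg.sub_proj_mem s) (hg'.sub_proj_mem t))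
  rw [sub_mul, mul_sub, mul_sub, map_sub, map_sub, map_sub, h0] at h1
  linear_combination -h1

/-! ### Alternation and skew-symmetry -/

section Alternation

variable {g : Type*} {n : ℕ}

theorem alternation_add (S T : (Fin n → g) → ℂ) :
    alternation (S + T) = alternation S + alternation T := by
  ext x
  simp [alternation, mul_add, Finset.sum_add_distrib]

theorem alternation_comp (σ : Equiv.Perm (Fin n)) (T : (Fin n → g) → ℂ) :
    alternation (fun x => T (x ∘ σ)) = ((Equiv.Perm.sign σ : ℤ) : ℂ) • alternation T := by
  ext x
  simp only [alternation, Pi.smul_apply, smul_eq_mul, Finset.mul_sum]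
  refine Fintype.sum_equiv (Equiv.mulRight σ) _ _ fun π => ?_
  have h : ((Equiv.Perm.sign σ : ℤ) : ℂ) * ((Equiv.Perm.sign σ : ℤ) : ℂ) = 1 := by
    rcases Int.units_eq_one_or (Equiv.Perm.sign σ) with h | h <;> simp [h]
  rw [Equiv.coe_mulRight, Equiv.Perm.sign_mul, Equiv.Perm.coe_mul, Function.comp_assoc]
  push_cast
  linear_combination (-((Equiv.Perm.sign π : ℤ) : ℂ) * T (x ∘ π ∘ σ)) * h

theorem IsSkew.alternation_eq {T : (Fin n → g) → ℂ} (hT : IsSkew T) :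
    alternation T = (n.factorial : ℂ) • T := by
  ext x
  have h : ∀ σ : Equiv.Perm (Fin n),
      ((Equiv.Perm.sign σ : ℤ) : ℂ) * T (x ∘ σ) = T x := fun σ => by
    rw [hT]
    rcases Int.units_eq_one_or (Equiv.Perm.sign σ) with h | h <;> simp [h]
  simp [alternation, h, Fintype.card_perm]

/-- The adjacent transpositions generate the symmetric group. -/
theorem isSkew_of_adjacent {T : (Fin (n + 1) → g) → ℂ}
    (h : ∀ (i : Fin n) x, T (x ∘ Equiv.swap i.castSucc i.succ) = -T x) : IsSkew T := by
  let S : Submonoid (Equiv.Perm (Fin (n + 1))) :=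
    { carrier := {σ | ∀ x, T (x ∘ σ) = ((Equiv.Perm.sign σ : ℤ) : ℂ) * T x}
      one_mem' := fun x => by simp
      mul_mem' := fun {σ π} hσ hπ x => by
        rw [Equiv.Perm.coe_mul, ← Function.comp_assoc, hπ, hσ, Equiv.Perm.sign_mul]
        push_cast
        ring }
  have hS : S = ⊤ := by
    rw [eq_top_iff, ← Equiv.Perm.mclosure_swap_castSucc_succ, Submonoid.closure_le]
    rintro _ ⟨i, rfl⟩ x
    rw [h, Equiv.Perm.sign_swap (Fin.castSucc_lt_succ).ne]
    simp
  intro σ x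
  have : σ ∈ S := hS ▸ Submonoid.mem_top σ
  exact this x

end Alternation

/-! ### Quasi-Lie bialgebras from isotropic splittings -/

section Splitting

variable {g : Type*} [LieRing g] [LieAlgebra ℂ g] {B : LinearMap.BilinForm ℂ g}

/-- A nondegenerate invariant symmetric form `B` on a Lie algebra together with an operator `Q` such
that `Q` and its complement `1 - Q` are adjoint to each other with isotropic images, and the image
of `1 - Q` is a subalgebra. Then `Q` is the projection onto an isotropic subspace along a
complementary isotropic subalgebra. -/
structure IsIsotropicSplitting (B : LinearMap.BilinForm ℂ g) (Q : g →ₗ[ℂ] g) : Prop where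
  symm : ∀ x y, B x y = B y x
  invariant : ∀ x y z, B ⁅x, y⁆ z = B x ⁅y, z⁆
  nondegenerate : ∀ x, (∀ y, B x y = 0) → x = 0
  isotropic : ∀ x y, B (Q x) (Q y) = 0
  adjoint : ∀ x y, B (Q x) y + B x (Q y) = B x y
  closed : ∀ x y, Q ⁅x - Q x, y - Q y⁆ = 0

/-- The co-bracket `[w ⊗ 1 + 1 ⊗ w, r]` for the tensor `r` with `r(x, y) = B(x, Q y)`. -/
def splittingCobracket (B : LinearMap.BilinForm ℂ g) (Q : g →ₗ[ℂ] g) (w : g) :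
    (Fin 2 → g) → ℂ :=
  fun x => B (x 0) (⁅w, Q (x 1)⁆ - Q ⁅w, x 1⁆)

/-- The obstruction to the image of `Q` being a subalgebra. -/
def splittingAssociator (B : LinearMap.BilinForm ℂ g) (Q : g →ₗ[ℂ] g) : (Fin 3 → g) → ℂ :=
  fun x => -B (Q (x 0)) ⁅Q (x 1), Q (x 2)⁆

theorem representative_spec {l : g → ℂ} (h : ∃ a, ∀ y, l y = B a y) (y : g) :
    B (representative B l) y = l y := by
  obtain ⟨a, ha⟩ := h
  exact Classical.epsilon_spec (p := fun a => ∀ y, B a y = l y) ⟨a, fun y => (ha y).symm⟩ y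

namespace IsIsotropicSplitting

variable {Q : g →ₗ[ℂ] g}

theorem lie_cyclic (hQ : IsIsotropicSplitting B Q) (x y z : g) : B x ⁅y, z⁆ = B y ⁅z, x⁆ := by
  rw [← hQ.invariant y, hQ.symm]

theorem lie_swap (x y z : g) : B x ⁅z, y⁆ = -B x ⁅y, z⁆ := by
  rw [← lie_skew, map_neg]

theorem lie_swap_left (hQ : IsIsotropicSplitting B Q) (x y z : g) : B y ⁅x, z⁆ = -B x ⁅y, z⁆ := by
  rw [hQ.lie_cyclic x y z, lie_swap]

theorem form_Q_left (hQ : IsIsotropicSplitting B Q) (x y : g) : B (Q x) y = B x (y - Q y) := by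
  rw [map_sub, ← hQ.adjoint x y]; ring

theorem form_Q_right (hQ : IsIsotropicSplitting B Q) (x y : g) : B x (Q y) = B (x - Q x) y := by
  rw [map_sub, LinearMap.sub_apply, ← hQ.adjoint x y]; ring

theorem form_complement_lie (hQ : IsIsotropicSplitting B Q) (x y z : g) :
    B (x - Q x) ⁅y - Q y, z - Q z⁆ = 0 := by
  rw [← hQ.form_Q_right, hQ.closed, map_zero]

/-- Two expressions of the co-bracket: as a commutator with `Q`, and by the defects of the images of
`1 - Q` and `Q`. -/
theorem splittingCobracket_eq (hQ : IsIsotropicSplitting B Q) (w x y : g) :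
    B x (⁅w, Q y⁆ - Q ⁅w, y⁆) = B w (⁅x - Q x, y - Q y⁆ - ⁅Q x, Q y⁆) := by
  rw [map_sub, hQ.form_Q_right, hQ.lie_swap_left w x, hQ.lie_swap_left w (x - Q x)]
  simp only [lie_sub, sub_lie, map_sub]
  ring

theorem splittingCobracket_skew (hQ : IsIsotropicSplitting B Q) (w : g) :
    IsSkew (splittingCobracket B Q w) := by
  refine isSkew_of_adjacent fun i x => ?_
  fin_cases i
  change B (x 1) (⁅w, Q (x 0)⁆ - Q ⁅w, x 0⁆) = -B (x 0) (⁅w, Q (x 1)⁆ - Q ⁅w, x 1⁆)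
  rw [hQ.splittingCobracket_eq, hQ.splittingCobracket_eq, ← lie_skew, ← lie_skew (Q (x 1)),
    ← map_neg]
  congr 1
  abel

theorem splittingCobracket_mem (hQ : IsIsotropicSplitting B Q) (w : g) :
    splittingCobracket B Q w ∈ completedTensor B 2 := by
  intro i x
  fin_cases i
  · exact ⟨⁅w, Q (x 1)⁆ - Q ⁅w, x 1⁆, fun y => by simp [splittingCobracket, hQ.symm y]⟩
  · refine ⟨-(⁅w, Q (x 0)⁆ - Q ⁅w, x 0⁆), fun y => ?_⟩
    have := hQ.splittingCobracket_skew w (Equiv.swap 0 1) ![y, x 0]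
    simp only [Equiv.Perm.sign_swap (show (0 : Fin 2) ≠ 1 by decide)] at this
    change B (x 0) (⁅w, Q y⁆ - Q ⁅w, y⁆) = _ * B y (⁅w, Q (x 0)⁆ - Q ⁅w, x 0⁆) at this
    change B (x 0) (⁅w, Q y⁆ - Q ⁅w, y⁆) = _
    rw [this, hQ.symm y, map_neg, LinearMap.neg_apply]
    simp

theorem splittingAssociator_skew (hQ : IsIsotropicSplitting B Q) :
    IsSkew (splittingAssociator B Q) := by
  refine isSkew_of_adjacent fun i x => ?_
  fin_cases i
  · change -B (Q (x 1)) ⁅Q (x 0), Q (x 2)⁆ = - -B (Q (x 0)) ⁅Q (x 1), Q (x 2)⁆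
    rw [hQ.lie_swap_left]
  · change -B (Q (x 0)) ⁅Q (x 2), Q (x 1)⁆ = - -B (Q (x 0)) ⁅Q (x 1), Q (x 2)⁆
    rw [lie_swap]

theorem splittingAssociator_eq (hQ : IsIsotropicSplitting B Q) (x y z : g) :
    -B (Q x) ⁅Q y, Q z⁆ = B (-(⁅Q y, Q z⁆ - Q ⁅Q y, Q z⁆)) x := by
  rw [hQ.form_Q_left, hQ.symm, map_neg, LinearMap.neg_apply]

theorem splittingAssociator_mem (hQ : IsIsotropicSplitting B Q) :
    splittingAssociator B Q ∈ completedTensor B 3 := by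
  intro i x
  fin_cases i
  · exact ⟨_, fun y => hQ.splittingAssociator_eq y (x 1) (x 2)⟩
  · refine ⟨-(⁅Q (x 2), Q (x 0)⁆ - Q ⁅Q (x 2), Q (x 0)⁆), fun y => ?_⟩
    rw [← hQ.splittingAssociator_eq y (x 2) (x 0)]
    change -B (Q (x 0)) ⁅Q y, Q (x 2)⁆ = -B (Q y) ⁅Q (x 2), Q (x 0)⁆
    rw [hQ.lie_cyclic]
  · refine ⟨-(⁅Q (x 0), Q (x 1)⁆ - Q ⁅Q (x 0), Q (x 1)⁆), fun y => ?_⟩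
    rw [← hQ.splittingAssociator_eq y (x 0) (x 1)]
    change -B (Q (x 0)) ⁅Q (x 1), Q y⁆ = -B (Q y) ⁅Q (x 0), Q (x 1)⁆
    rw [← hQ.lie_cyclic]

/-- By invariance, the adjoint action on functionals is the contragredient one. -/
theorem adjointAction_apply (hQ : IsIsotropicSplitting B Q) {n : ℕ} {T : (Fin n → g) → ℂ}
    (hT : T ∈ completedTensor B n) (w : g) (x : Fin n → g) :
    adjointAction B w T x = -∑ i, T (Function.update x i ⁅w, x i⁆) := by
  rw [adjointAction, Finset.sum_apply, ← Finset.sum_neg_distrib]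
  refine Finset.sum_congr rfl fun i _ => ?_
  rw [mapAt, ← lie_skew, map_neg, LinearMap.neg_apply, hQ.invariant, representative_spec (hT i x)]

theorem mapFirst_apply (hQ : IsIsotropicSplitting B Q) (δ : g → (Fin 2 → g) → ℂ) {n : ℕ}
    (T : (Fin (n + 1) → g) → ℂ) (x : Fin (n + 2) → g) (r : g)
    (hr : ∀ y, T (Fin.cons y fun j => x j.succ.succ) = B r y) :
    mapFirst B δ T x = δ r ![x 0, x 1] := by
  rw [mapFirst]
  congr 1
  rw [← sub_eq_zero]
  refine hQ.nondegenerate _ fun y => ?_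
  rw [map_sub, LinearMap.sub_apply, representative_spec ⟨r, hr⟩, hr, sub_self]

/-- The co-Jacobi defect before the alternation, summed over the cyclic permutations of the
arguments. -/
theorem cyclic_sum_eq (hQ : IsIsotropicSplitting B Q) (w x y z : g) :
    B (⁅w, Q z⁆ - Q ⁅w, z⁆) (⁅x - Q x, y - Q y⁆ - ⁅Q x, Q y⁆) +
      B (⁅w, Q x⁆ - Q ⁅w, x⁆) (⁅y - Q y, z - Q z⁆ - ⁅Q y, Q z⁆) +
      B (⁅w, Q y⁆ - Q ⁅w, y⁆) (⁅z - Q z, x - Q x⁆ - ⁅Q z, Q x⁆) =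
    B (Q ⁅w, x⁆) ⁅Q y, Q z⁆ + B (Q x) ⁅Q ⁅w, y⁆, Q z⁆ + B (Q x) ⁅Q y, Q ⁅w, z⁆⁆ := by
  have jac : ∀ p q r : g, B ⁅w, r⁆ ⁅p, q⁆ + B ⁅w, p⁆ ⁅q, r⁆ + B ⁅w, q⁆ ⁅r, p⁆ = 0 := fun p q r => by
    have := congrArg (B w) (lie_jacobi r p q)
    rw [map_add, map_add, map_zero] at this
    rw [hQ.invariant, hQ.invariant, hQ.invariant, ← this]
  -- On the image of `1 - Q`, a subalgebra, `Q` can be dropped in the pairing with a bracket.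
  have key : ∀ u p q : g, B (Q u) ⁅p - Q p, q - Q q⁆ = B u ⁅p - Q p, q - Q q⁆ := fun u p q => by
    rw [hQ.form_Q_left, hQ.closed, sub_zero]
  have h1 := jac (Q x) (Q y) (Q z)
  have h2 := jac (x - Q x) (y - Q y) (z - Q z)
  rw [hQ.lie_cyclic (Q x) (Q ⁅w, y⁆), ← hQ.lie_cyclic (Q ⁅w, z⁆) (Q x)]
  simp only [map_sub, LinearMap.sub_apply, key, lie_sub w] at h1 h2 ⊢
  linear_combination -h1 - h2

theorem coJacobi (hQ : IsIsotropicSplitting B Q) (w : g) :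
    (1 / 2 : ℂ) • alternation (mapFirst B (splittingCobracket B Q) (splittingCobracket B Q w)) =
      adjointAction B w (splittingAssociator B Q) := by
  set T := mapFirst B (splittingCobracket B Q) (splittingCobracket B Q w) with hT
  set S := adjointAction B w (splittingAssociator B Q) with hS
  have hTx : ∀ x, T x = B (⁅w, Q (x 2)⁆ - Q ⁅w, x 2⁆)
      (⁅x 0 - Q (x 0), x 1 - Q (x 1)⁆ - ⁅Q (x 0), Q (x 1)⁆) := fun x => by
    rw [hT, hQ.mapFirst_apply _ _ _ (⁅w, Q (x 2)⁆ - Q ⁅w, x 2⁆) fun y => hQ.symm _ _]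
    exact hQ.splittingCobracket_eq _ _ _
  have hSx : ∀ x, S x = B (Q ⁅w, x 0⁆) ⁅Q (x 1), Q (x 2)⁆ + B (Q (x 0)) ⁅Q ⁅w, x 1⁆, Q (x 2)⁆ +
      B (Q (x 0)) ⁅Q (x 1), Q ⁅w, x 2⁆⁆ := fun x => by
    rw [hS, hQ.adjointAction_apply hQ.splittingAssociator_mem, Fin.sum_univ_three]
    simp [splittingAssociator]
    ring
  have hcyc : T + (fun x => T (x ∘ finRotate 3)) +
      (fun x => T (x ∘ (finRotate 3 * finRotate 3 : Equiv.Perm (Fin 3)))) = S := by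
    ext x
    simp only [Pi.add_apply, hTx, hSx]
    exact hQ.cyclic_sum_eq w (x 0) (x 1) (x 2)
  have hskew : IsSkew S := by
    refine isSkew_of_adjacent fun i x => ?_
    fin_cases i
    · rw [hSx, hSx]
      change B (Q ⁅w, x 1⁆) ⁅Q (x 0), Q (x 2)⁆ + B (Q (x 1)) ⁅Q ⁅w, x 0⁆, Q (x 2)⁆ +
        B (Q (x 1)) ⁅Q (x 0), Q ⁅w, x 2⁆⁆ = _
      rw [hQ.lie_swap_left (Q (x 0)), hQ.lie_swap_left (Q ⁅w, x 0⁆), hQ.lie_swap_left (Q (x 0))]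
      ring
    · rw [hSx, hSx]
      change B (Q ⁅w, x 0⁆) ⁅Q (x 2), Q (x 1)⁆ + B (Q (x 0)) ⁅Q ⁅w, x 2⁆, Q (x 1)⁆ +
        B (Q (x 0)) ⁅Q (x 2), Q ⁅w, x 1⁆⁆ = _
      rw [lie_swap _ (Q (x 1)), lie_swap _ (Q (x 1)), lie_swap _ _ (Q (x 2))]
      ring
  have h := congrArg alternation hcyc
  rw [alternation_add, alternation_add, alternation_comp, alternation_comp, hskew.alternation_eq,
    Equiv.Perm.sign_mul, sign_finRotate] at h
  ext x
  have hx := congrFun h x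
  simp [Nat.factorial] at hx ⊢
  linear_combination (1 / 6) * hx

theorem compatibility (hQ : IsIsotropicSplitting B Q) :
    alternation (mapFirst B (splittingCobracket B Q) (splittingAssociator B Q)) = 0 := by
  set F := mapFirst B (splittingCobracket B Q) (splittingAssociator B Q) with hF
  set G : (Fin 4 → g) → ℂ := fun x => B ⁅Q (x 0), Q (x 1)⁆ ⁅Q (x 2), Q (x 3)⁆ with hG
  have hFx : ∀ x, F x = B (⁅Q (x 2), Q (x 3)⁆ - Q ⁅Q (x 2), Q (x 3)⁆) ⁅Q (x 0), Q (x 1)⁆ := by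
    intro x
    rw [hF, hQ.mapFirst_apply _ _ _ (-(⁅Q (x 2), Q (x 3)⁆ - Q ⁅Q (x 2), Q (x 3)⁆))
      fun y => hQ.splittingAssociator_eq y (x 2) (x 3)]
    refine (hQ.splittingCobracket_eq _ _ _).trans ?_
    change B _ (⁅x 0 - Q (x 0), x 1 - Q (x 1)⁆ - ⁅Q (x 0), Q (x 1)⁆) = _
    rw [map_sub, map_neg, LinearMap.neg_apply, LinearMap.neg_apply, hQ.form_complement_lie]
    ring
  -- The alternation of `F` is that of its symmetrization, in which `Q` disappears.
  have h1 : F + (fun x => F (x ∘ (Equiv.swap 0 2 * Equiv.swap 1 3 : Equiv.Perm (Fin 4)))) = G := by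
    ext x
    simp only [Pi.add_apply, hFx, hG]
    change B (⁅Q (x 2), Q (x 3)⁆ - Q ⁅Q (x 2), Q (x 3)⁆) ⁅Q (x 0), Q (x 1)⁆ +
      B (⁅Q (x 0), Q (x 1)⁆ - Q ⁅Q (x 0), Q (x 1)⁆) ⁅Q (x 2), Q (x 3)⁆ = _
    rw [← hQ.form_Q_right, map_sub, LinearMap.sub_apply, hQ.symm _ (Q _)]
    ring
  have h2 : G + (fun x => G (x ∘ (Equiv.swap 1 2 * Equiv.swap 2 3 : Equiv.Perm (Fin 4)))) +
      (fun x => G (x ∘ (Equiv.swap 2 3 * Equiv.swap 1 2 : Equiv.Perm (Fin 4)))) = 0 := by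
    ext x
    simp only [Pi.add_apply, hG]
    change B ⁅Q (x 0), Q (x 1)⁆ ⁅Q (x 2), Q (x 3)⁆ + B ⁅Q (x 0), Q (x 2)⁆ ⁅Q (x 3), Q (x 1)⁆ +
      B ⁅Q (x 0), Q (x 3)⁆ ⁅Q (x 1), Q (x 2)⁆ = 0
    rw [hQ.invariant, hQ.invariant, hQ.invariant, ← map_add, ← map_add, lie_jacobi, map_zero]
  have s1 : Equiv.Perm.sign (Equiv.swap 0 2 * Equiv.swap 1 3 : Equiv.Perm (Fin 4)) = 1 := by decide
  have s2 : Equiv.Perm.sign (Equiv.swap 1 2 * Equiv.swap 2 3 : Equiv.Perm (Fin 4)) = 1 := by decide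
  have s3 : Equiv.Perm.sign (Equiv.swap 2 3 * Equiv.swap 1 2 : Equiv.Perm (Fin 4)) = 1 := by decide
  have h1 := congrArg alternation h1
  have h2 := congrArg alternation h2
  rw [alternation_add, alternation_comp, s1] at h1
  rw [alternation_add, alternation_add, alternation_comp, alternation_comp, s2, s3] at h2
  have h0 : alternation (0 : (Fin 4 → g) → ℂ) = 0 := by
    ext x
    simp [alternation]
  rw [h0] at h2
  ext x
  have h1 := congrFun h1 x
  have h2 := congrFun h2 x
  simp at h1 h2 ⊢
  linear_combination (1 / 2) * h1 + (1 / 6) * h2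

/-- An isotropic splitting defines a quasi-Lie bialgebra. -/
theorem isQuasiLieBialgebra (hQ : IsIsotropicSplitting B Q) :
    IsQuasiLieBialgebra B (splittingCobracket B Q) (splittingAssociator B Q) where
  map_add v w := by
    ext x
    simp [splittingCobracket]
    ring
  map_smul c w := by
    ext x
    simp [splittingCobracket]
    ring
  cobracket_mem := hQ.splittingCobracket_mem
  cobracket_skew := hQ.splittingCobracket_skew
  assoc_mem := hQ.splittingAssociator_mem
  assoc_skew := hQ.splittingAssociator_skew
  cocycle v w := by
    ext x
    rw [Pi.sub_apply, hQ.adjointAction_apply (hQ.splittingCobracket_mem _),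
      hQ.adjointAction_apply (hQ.splittingCobracket_mem _), Fin.sum_univ_two, Fin.sum_univ_two]
    have h : ∀ u y z : g, B ⁅u, y⁆ z = -B y ⁅u, z⁆ := fun u y z => by
      rw [hQ.invariant, hQ.lie_swap_left]
    simp [splittingCobracket, h]
    ring
  coJacobi := hQ.coJacobi
  compatibility := hQ.compatibility

end IsIsotropicSplitting
end Splitting

/-! ### Tensors given by series -/

section Expansion

variable {g : Type*} [LieRing g] [LieAlgebra ℂ g] {B : LinearMap.BilinForm ℂ g} {ι : Type*}

/-- The families `a`, `b` define a tensor `∑ aᵢ ⊗ bᵢ` whose functional is `(x, y) ↦ B(x, Q y)`,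
and the pairings of the `bᵢ`, and of their brackets, with any given element vanish almost
always. -/
structure IsTensorExpansion (B : LinearMap.BilinForm ℂ g) (Q : g →ₗ[ℂ] g) (a b : ι → g) :
    Prop where
  hasSum : ∀ (ψ : g → ℂ), IsLinearMap ℂ ψ → ∀ y, HasSum (fun i => B (b i) y * ψ (a i)) (ψ (Q y))
  finite : ∀ y, {i | B (b i) y ≠ 0}.Finite
  finite_lie : ∀ z, {p : ι × ι | B ⁅b p.1, b p.2⁆ z ≠ 0}.Finite

theorem hasSum_prod_of_finite {f : ι × ι → ℂ} (hf : f.support.Finite) {s : ι → ℂ} {t : ℂ}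
    (h1 : ∀ i, HasSum (fun j => f (i, j)) (s i)) (h2 : HasSum s t) : HasSum f t := by
  have h := (summable_of_hasFiniteSupport (L := .unconditional _) hf).hasSum
  have := (h.prod_fiberwise h1).unique h2
  rwa [this] at h

namespace IsTensorExpansion

variable {Q : g →ₗ[ℂ] g} {a b : ι → g}

theorem hasSum_form (h : IsTensorExpansion B Q a b) (x y : g) :
    HasSum (fun i => B (b i) y * B (a i) x) (B (Q y) x) :=
  h.hasSum (fun u => B u x) ⟨fun _ _ => by simp, fun _ _ => by simp⟩ y

theorem hasSum_form_lie (h : IsTensorExpansion B Q a b) (c : ℂ) (v x y : g) :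
    HasSum (fun i => B (b i) y * (c * B ⁅v, a i⁆ x)) (c * B ⁅v, Q y⁆ x) :=
  h.hasSum (fun u => c * B ⁅v, u⁆ x)
    ⟨fun _ _ => by simp [mul_add], fun _ _ => by simp [mul_left_comm]⟩ y

theorem hasSum_pureTensor (h : IsTensorExpansion B Q a b) :
    HasSum (fun i => pureTensor B ![a i, b i]) (fun x => B (Q (x 1)) (x 0)) := by
  refine Pi.hasSum.2 fun x => ?_
  simpa [pureTensor, Fin.prod_univ_two, mul_comm] using
    h.hasSum_form (x 0) (x 1)

theorem hasSum_cobracket (h : IsTensorExpansion B Q a b) (hQ : IsIsotropicSplitting B Q) (w : g) :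
    HasSum (fun i => pureTensor B ![⁅w, a i⁆, b i] + pureTensor B ![a i, ⁅w, b i⁆])
      (splittingCobracket B Q w) := by
  refine Pi.hasSum.2 fun x => ?_
  have h1 := h.hasSum_form_lie 1 w (x 0) (x 1)
  have h2 := h.hasSum_form (x 0) ⁅w, x 1⁆
  convert! h1.sub h2 using 1
  · ext i
    have e : B ⁅w, b i⁆ (x 1) = -B (b i) ⁅w, x 1⁆ := by rw [hQ.invariant, hQ.lie_swap_left]
    simp [pureTensor, Fin.prod_univ_two, e]
    ring
  · simp [splittingCobracket, hQ.symm]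

/-- The expansion of `[r₁₂, r₁₃]`. -/
theorem hasSum_lie_left (h : IsTensorExpansion B Q a b) :
    HasSum (fun p : ι × ι => pureTensor B ![⁅a p.1, a p.2⁆, b p.1, b p.2])
      (fun x => B ⁅Q (x 1), Q (x 2)⁆ (x 0)) := by
  refine Pi.hasSum.2 fun x => ?_
  refine hasSum_prod_of_finite (s := fun i => B (b i) (x 1) * B ⁅a i, Q (x 2)⁆ (x 0)) ?_ ?_ ?_
  · refine ((h.finite (x 1)).prod (h.finite (x 2))).subset fun p hp => ?_
    constructor <;> intro h0 <;> exact hp (by simp [pureTensor, Fin.prod_univ_three, h0])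
  · intro i
    convert! h.hasSum_form_lie (B (b i) (x 1)) (a i) (x 0) (x 2) using 1
    ext j
    simp [pureTensor, Fin.prod_univ_three]
    ring
  · exact h.hasSum (fun u => B ⁅u, Q (x 2)⁆ (x 0))
      ⟨fun _ _ => by simp, fun _ _ => by simp⟩ (x 1)

/-- The expansion of `[r₁₂, r₂₃]`. -/
theorem hasSum_lie_middle (h : IsTensorExpansion B Q a b) (hQ : IsIsotropicSplitting B Q) :
    HasSum (fun p : ι × ι => pureTensor B ![a p.1, ⁅b p.1, a p.2⁆, b p.2])
      (fun x => B (Q ⁅Q (x 2), x 1⁆) (x 0)) := by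
  refine Pi.hasSum.2 fun x => ?_
  refine hasSum_prod_of_finite (s := fun i => B (b i) ⁅Q (x 2), x 1⁆ * B (a i) (x 0)) ?_ ?_ ?_
  · refine ((h.finite (x 2)).biUnion fun j _ =>
      ((h.finite ⁅a j, x 1⁆).image fun i => (i, j))).subset fun p hp => ?_
    simp only [Set.mem_iUnion, Set.mem_image]
    refine ⟨p.2, fun h0 => hp ?_, p.1, fun h0 => hp ?_, rfl⟩
    · simp [pureTensor, Fin.prod_univ_three, h0]
    · simp [pureTensor, Fin.prod_univ_three, hQ.invariant, h0]
  · intro i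
    convert! h.hasSum_form_lie (B (a i) (x 0)) (b i) (x 1) (x 2) using 1
    · ext j
      simp [pureTensor, Fin.prod_univ_three]
      ring
    · rw [hQ.invariant, mul_comm]
  · exact h.hasSum_form (x 0) ⁅Q (x 2), x 1⁆

/-- The expansion of `[r₁₃, r₂₃]`. -/
theorem hasSum_lie_right (h : IsTensorExpansion B Q a b) (hQ : IsIsotropicSplitting B Q) :
    HasSum (fun p : ι × ι => pureTensor B ![a p.1, a p.2, ⁅b p.1, b p.2⁆])
      (fun x => B (Q ⁅x 1 - Q (x 1), x 2⁆) (x 0)) := by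
  refine Pi.hasSum.2 fun x => ?_
  refine hasSum_prod_of_finite
    (s := fun i => B (b i) ⁅x 1 - Q (x 1), x 2⁆ * B (a i) (x 0)) ?_ ?_ ?_
  · refine (h.finite_lie (x 2)).subset fun p hp h0 => hp ?_
    simp [pureTensor, Fin.prod_univ_three, h0]
  · intro i
    convert! (h.hasSum_form (x 1) ⁅x 2, b i⁆).mul_right (B (a i) (x 0)) using 1
    · ext j
      simp [pureTensor, Fin.prod_univ_three]
      rw [hQ.invariant, hQ.lie_cyclic (b i)]
      ring
    · rw [hQ.form_Q_left, hQ.symm _ (x 1 - _), hQ.lie_cyclic (b i)]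
  · exact h.hasSum_form (x 0) ⁅x 1 - Q (x 1), x 2⁆

/-- For an isotropic splitting, the left hand side of the Yang-Baxter equation measures the failure
of the image of `Q` to be a subalgebra. -/
theorem yangBaxter_eq (hQ : IsIsotropicSplitting B Q) (x y z : g) :
    B ⁅Q y, Q z⁆ x + B (Q ⁅Q z, y⁆) x + B (Q ⁅y - Q y, z⁆) x = B (Q x) ⁅Q y, Q z⁆ := by
  rw [hQ.form_Q_left, hQ.form_Q_left, hQ.symm ⁅Q y, Q z⁆, hQ.symm ⁅Q z, y⁆,
    hQ.symm ⁅y - Q y, z⁆, ← lie_skew (Q z) y]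
  have h2 := hQ.form_complement_lie x y z
  simp only [lie_sub, sub_lie, map_sub, map_neg, LinearMap.sub_apply] at h2 ⊢
  linear_combination h2

end IsTensorExpansion
end Expansion

/-! ### Parity, poles and zeros of theta quotients -/

theorem residue_comp_neg {s : ℂ → ℂ} (hs : MeromorphicAt s 0)
    (hs' : MeromorphicAt (fun u => s (-u)) 0) : residue (fun u => s (-u)) = -residue s := by
  refine residue_eq_of hs' ?_
  filter_upwards [residue_spec hs] with ρ h1
  rw [← h1.2, contourIntegral, contourIntegral, ← mul_neg]
  congr 1
  simp only [circleIntegral, deriv_circleMap, smul_eq_mul]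
  set F : ℝ → ℂ := fun t => circleMap 0 ρ t * Complex.I * s (circleMap 0 ρ t) with hF
  have hper : Function.Periodic F (2 * Real.pi) := fun t => by
    simp only [hF, periodic_circleMap 0 ρ t]
  have hpi : ∀ t, circleMap 0 ρ (t + Real.pi) = -circleMap 0 ρ t := fun t => by
    simp [circleMap, add_mul, Complex.exp_add, Complex.exp_pi_mul_I]
  have h := hper.intervalIntegral_add_eq Real.pi 0
  rw [zero_add] at h
  rw [← h, ← intervalIntegral.integral_neg]
  have h2 := intervalIntegral.integral_comp_add_right (a := 0) (b := 2 * Real.pi)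
    (fun t => -F t) Real.pi
  rw [zero_add, add_comm (2 * Real.pi)] at h2
  rw [← h2]
  congr 1
  ext t
  simp [hF, hpi]

theorem meromorphicAt_iterate_deriv {s : ℂ → ℂ} (hs : MeromorphicAt s 0) (n : ℕ) :
    MeromorphicAt (deriv^[n] s) 0 := by
  induction n with
  | zero => exact hs
  | succ n ih => rw [Function.iterate_succ_apply']; exact ih.deriv

theorem K0.D_pow_mk {s : ℂ → ℂ} (hs : MeromorphicAt s 0) (n : ℕ) :
    (K0.D ^ n) (K0.mk s hs) = K0.mk (deriv^[n] s) (meromorphicAt_iterate_deriv hs n) := by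
  induction n with
  | zero => rfl
  | succ n ih =>
    rw [pow_succ', Module.End.mul_apply, ih, K0.D_mk]
    exact K0.mk_congr _ _ (Function.iterate_succ_apply' deriv n s).symm

section Theta

variable (τ : UpperHalfPlane)

theorem differentiable_theta : Differentiable ℂ (theta τ) :=
  (isOddTheta_theta τ.im_pos).differentiable

theorem theta_zero : theta τ 0 = 0 := by
  have := (isOddTheta_theta τ.im_pos).odd 0
  rw [neg_zero] at this
  exact self_eq_neg.1 this

theorem deriv_theta_neg (u : ℂ) : deriv (theta τ) (-u) = deriv (theta τ) u := by
  have h : (fun u => theta τ (-u)) = fun u => -theta τ u :=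
    funext (isOddTheta_theta τ.im_pos).odd
  have h1 := congrFun (congrArg deriv h) u
  rw [deriv_comp_neg, deriv.fun_neg] at h1
  exact neg_inj.1 h1

theorem green_neg (lam u : ℂ) : green τ lam (-u) = -green τ (-lam) u := by
  have hodd := (isOddTheta_theta τ.im_pos).odd
  by_cases h : lam = 0
  · simp [green, h, hodd, deriv_theta_neg, div_neg]
  · have e : -u + lam = -(u + -lam) := by ring
    rw [green, green, if_neg h, if_neg (neg_ne_zero.2 h), e]
    simp only [hodd]
    simp [div_neg]
    ring

/-- The pairing is antisymmetric under `u ↦ -u`, while this substitution interchanges the spans of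
the derivatives of the two functions. -/
theorem res_green_mul_green (lam : ℂ) (n m : ℕ) :
    K0.res ((K0.D ^ n) (greenGerm τ lam) * (K0.D ^ m) (greenGerm τ (-lam))) = 0 := by
  have key : ∀ k : ℕ, K0.res ((K0.D ^ k) (greenGerm τ lam) * greenGerm τ (-lam)) = 0 := by
    intro k
    have hm := meromorphicAt_iterate_deriv (meromorphicAt_green τ lam) k
    have hm' := meromorphicAt_iterate_deriv (meromorphicAt_green τ (-lam)) k
    have e : (fun u => deriv^[k] (green τ lam) (-u) * green τ (-lam) (-u)) =
        fun u => (-1) ^ k * (deriv^[k] (green τ (-lam)) u * green τ lam u) := by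
      ext u
      have h1 := iteratedDeriv_comp_neg k (green τ lam) u
      have h2 : (fun u => green τ lam (-u)) = fun u => -green τ (-lam) u :=
        funext (green_neg τ lam)
      rw [h2, iteratedDeriv_fun_neg, iteratedDeriv_eq_iterate, iteratedDeriv_eq_iterate,
        smul_eq_mul] at h1
      have h3 : deriv^[k] (green τ lam) (-u) = -((-1) ^ k * deriv^[k] (green τ (-lam)) u) := by
        have : ((-1 : ℂ) ^ k) * (-1) ^ k = 1 := by rw [← mul_pow]; simp
        linear_combination (-deriv^[k] (green τ lam) (-u)) * this - (-1) ^ k * h1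
      rw [h3, green_neg, neg_neg]
      ring
    have hr := (MeromorphicAt.const ((-1 : ℂ) ^ k) 0).mul (hm'.mul (meromorphicAt_green τ lam))
    have h := residue_comp_neg (hm.mul (meromorphicAt_green τ (-lam))) (by
      simpa only [Pi.mul_apply, e] using! hr)
    have h1 : residue (fun u => (-1) ^ k * (deriv^[k] (green τ (-lam)) u * green τ lam u)) =
        (-1) ^ k * K0.res ((K0.D ^ k) (greenGerm τ (-lam)) * greenGerm τ lam) := by
      rw [greenGerm, K0.D_pow_mk, greenGerm, ← K0.mk_mul, ← smul_eq_mul, ← map_smul, ← K0.mk_smul,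
        K0.res_mk]
    have h2 : residue (fun u => deriv^[k] (green τ lam) u * green τ (-lam) u) =
        K0.res ((K0.D ^ k) (greenGerm τ lam) * greenGerm τ (-lam)) := by
      rw [greenGerm, K0.D_pow_mk, greenGerm, ← K0.mk_mul, K0.res_mk]
    have h3 : residue (fun u => deriv^[k] (green τ lam) (-u) * green τ (-lam) (-u)) =
        -residue (fun u => deriv^[k] (green τ lam) u * green τ (-lam) u) := h
    rw [e, h1, h2, mul_comm _ (greenGerm τ lam), res_mul_D_pow, ← mul_assoc, ← mul_pow] at h3
    simp only [mul_neg, mul_one, neg_neg, one_pow, one_mul] at h3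
    exact self_eq_neg.1 h3
  rw [res_mul_D_pow, ← Module.End.mul_apply, ← pow_add, key, mul_zero]

/-- The function `u / θ(u)`, without its removable singularity. -/
theorem analyticAt_dslope_theta : AnalyticAt ℂ (dslope (theta τ) 0) 0 := by
  obtain ⟨p, hp⟩ := (differentiable_theta τ).analyticAt 0
  exact ⟨_, hp.has_fpower_series_dslope_fslope⟩

theorem dslope_theta_zero : dslope (theta τ) 0 0 = 1 := by
  rw [dslope_same, (isOddTheta_theta τ.im_pos).deriv_zero]

theorem theta_eq_mul_dslope (u : ℂ) : theta τ u = u * dslope (theta τ) 0 u := by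
  have := sub_smul_dslope (theta τ) 0 u
  rw [theta_zero, sub_zero, sub_zero, smul_eq_mul] at this
  exact this.symm

theorem isSimplePole_of {g o : ℂ → ℂ} (hg : MeromorphicAt g 0) (ho : AnalyticAt ℂ o 0)
    (h0 : o 0 = 1) (h : ∀ u, g u = o u * u⁻¹) : IsSimplePole (K0.mk g hg) := by
  have e : K0.mk g hg = K0.mk o ho.meromorphicAt * coordInv :=
    K0.mk_congr _ (ho.meromorphicAt.mul (MeromorphicAt.id 0).inv) (funext h)
  refine ⟨?_, by rw [e, res_mul_coordInv ho, h0]⟩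
  rw [e, mul_left_comm, coord_mul_coordInv, mul_one]
  exact ⟨_, ho, rfl⟩

theorem isSimplePole_greenGerm {lam : ℂ} (h : lam = 0 ∨ theta τ lam ≠ 0) :
    IsSimplePole (greenGerm τ lam) := by
  have hd := differentiable_theta τ
  have h1 := dslope_theta_zero τ
  have h2 : dslope (theta τ) 0 0 ≠ 0 := by rw [h1]; exact one_ne_zero
  by_cases h0 : lam = 0
  · refine isSimplePole_of (o := fun u => deriv (theta τ) u / dslope (theta τ) 0 u) _
      ((hd.analyticAt 0).deriv.div (analyticAt_dslope_theta τ) h2) ?_ fun u => ?_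
    · rw [h1, (isOddTheta_theta τ.im_pos).deriv_zero, div_one]
    · rw [green, if_pos h0, theta_eq_mul_dslope τ u]
      ring
  · have h3 := h.resolve_left h0
    have h4 : Differentiable ℂ fun u => theta τ (u + lam) := hd.comp (by fun_prop)
    refine isSimplePole_of
      (o := fun u => theta τ (u + lam) / (dslope (theta τ) 0 u * theta τ lam)) _
      ((h4.analyticAt 0).div ((analyticAt_dslope_theta τ).mul analyticAt_const)
        (mul_ne_zero h2 h3)) ?_ fun u => ?_
    · rw [h1, zero_add, one_mul, div_self h3]
    · rw [green, if_neg h0, theta_eq_mul_dslope τ u]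
      ring

/-- The zeros of the product that defines `θ`. -/
theorem theta_ne_zero {u : ℂ} (hu : u ∉ lattice τ) : theta τ u ≠ 0 := by
  have hq := norm_nome_lt_one τ.im_pos
  have hpi : (Real.pi : ℂ) ≠ 0 := by exact_mod_cast Real.pi_ne_zero
  have h2 := Complex.two_pi_I_ne_zero
  refine mul_ne_zero (div_ne_zero (fun h => ?_) hpi)
    (div_ne_zero (mul_ne_zero (qProd_ne_zero hq fun n h => ?_) (qProd_ne_zero hq fun n h => ?_))
      (pow_ne_zero _ (qProd_ne_zero hq fun n h => ?_)))
  · obtain ⟨k, hk⟩ := Complex.sin_eq_zero_iff.1 h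
    refine hu ⟨k, 0, ?_⟩
    have : u = k := mul_left_cancel₀ hpi (by rw [hk, mul_comm])
    simpa using this
  · rw [nome, ← Complex.exp_nat_mul, ← Complex.exp_add, Complex.exp_eq_one_iff] at h
    obtain ⟨k, hk⟩ := h
    refine hu ⟨k, -((n : ℤ) + 1), mul_left_cancel₀ h2 ?_⟩
    push_cast at hk ⊢
    linear_combination hk
  · rw [nome, ← Complex.exp_nat_mul, ← Complex.exp_add, Complex.exp_eq_one_iff] at h
    obtain ⟨k, hk⟩ := h
    refine hu ⟨-k, (n : ℤ) + 1, mul_left_cancel₀ h2 ?_⟩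
    push_cast at hk ⊢
    linear_combination -hk
  · have := congrArg norm h
    rw [mul_one, norm_pow, norm_one] at this
    exact (pow_lt_one₀ (norm_nonneg _) hq (Nat.succ_ne_zero n)).ne this

theorem eventually_theta_ne_zero (z : ℂ) : ∀ᶠ u in 𝓝[≠] z, theta τ u ≠ 0 := by
  have ha : AnalyticOnNhd ℂ (theta τ) Set.univ := fun u _ => (differentiable_theta τ).analyticAt u
  refine ((ha z trivial).eventually_eq_zero_or_eventually_ne_zero).resolve_left fun h => ?_
  have h0 : theta τ = 0 := ha.eq_of_eventuallyEq (g := 0) (fun u _ => analyticAt_const) h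
  have h1 := (isOddTheta_theta τ.im_pos).deriv_zero
  rw [h0] at h1
  simp at h1

theorem eventually_nhds_theta_ne_zero {z : ℂ} (hz : theta τ z ≠ 0) :
    ∀ᶠ u in 𝓝 z, theta τ u ≠ 0 :=
  (differentiable_theta τ).continuous.continuousAt.eventually_ne hz

theorem theta_add_one_eq_zero_iff (u : ℂ) : theta τ (u + 1) = 0 ↔ theta τ u = 0 := by
  rw [(isOddTheta_theta τ.im_pos).add_one, neg_eq_zero]

theorem theta_add_tau_eq_zero_iff (u : ℂ) : theta τ (u + τ) = 0 ↔ theta τ u = 0 := by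
  rw [(isOddTheta_theta τ.im_pos).add_tau]
  simp

end Theta

/-! ### Quasi-periodic functions and the residue theorem -/

/-- A function that is holomorphic off the period lattice, has period `1`, and is multiplied by `χ`
under the translation by `τ`, up to a summand `χ G`. The zeros of `θ` are the lattice points, where
the values do not matter. -/
structure IsQuasiPeriodic (τ : UpperHalfPlane) (χ : ℂ) (F G : ℂ → ℂ) : Prop where
  analyticAt : ∀ u, theta τ u ≠ 0 → AnalyticAt ℂ F u
  analyticAt_shift : ∀ u, theta τ u ≠ 0 → AnalyticAt ℂ G u
  add_one : ∀ u, theta τ u ≠ 0 → F (u + 1) = F u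
  add_tau : ∀ u, theta τ u ≠ 0 → F (u + τ) = χ * (F u + G u)

namespace IsQuasiPeriodic

variable {τ : UpperHalfPlane} {χ : ℂ} {F G : ℂ → ℂ}

theorem deriv (h : IsQuasiPeriodic τ χ F G) : IsQuasiPeriodic τ χ (deriv F) (deriv G) where
  analyticAt u hu := (h.analyticAt u hu).deriv
  analyticAt_shift u hu := (h.analyticAt_shift u hu).deriv
  add_one u hu := by
    rw [← deriv_comp_add_const]
    exact EventuallyEq.deriv_eq ((eventually_nhds_theta_ne_zero τ hu).mono h.add_one)
  add_tau u hu := by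
    rw [← deriv_comp_add_const,
      EventuallyEq.deriv_eq ((eventually_nhds_theta_ne_zero τ hu).mono h.add_tau),
      deriv_const_mul_field,
      deriv_fun_add (h.analyticAt u hu).differentiableAt (h.analyticAt_shift u hu).differentiableAt]

theorem iterate_deriv (h : IsQuasiPeriodic τ χ F G) (n : ℕ) :
    IsQuasiPeriodic τ χ (_root_.deriv^[n] F) (_root_.deriv^[n] G) := by
  induction n with
  | zero => exact h
  | succ n ih => rw [Function.iterate_succ_apply', Function.iterate_succ_apply']; exact ih.deriv

end IsQuasiPeriodic

/-- The function `∑ₙ Res((-u)ⁿ s) F⁽ⁿ⁾ / n!`, which represents `proj F s`. -/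
def projFun (F : ℂ → ℂ) (s : K0) (u : ℂ) : ℂ :=
  ∑ n ∈ (moments s).support, moments s n * ((n.factorial : ℂ)⁻¹ * deriv^[n] F u)

theorem K0.mk_sum {ι : Type*} (S : Finset ι) (f : ι → ℂ → ℂ) (hf : ∀ i, MeromorphicAt (f i) 0)
    (h : MeromorphicAt (fun u => ∑ i ∈ S, f i u) 0) :
    K0.mk (fun u => ∑ i ∈ S, f i u) h = ∑ i ∈ S, K0.mk (f i) (hf i) := by
  classical
  induction S using Finset.induction_on with
  | empty =>
    exact (K0.mk_congr _ (MeromorphicAt.const 0 0) (by ext u; simp)).trans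
      ((K0.mk_const 0).trans (map_zero _))
  | insert i S hi ih =>
    have h' : MeromorphicAt (fun u => ∑ i ∈ S, f i u) 0 := MeromorphicAt.fun_sum fun i _ => hf i
    rw [Finset.sum_insert hi, ← ih h', ← K0.mk_add]
    exact K0.mk_congr _ _ (by ext u; rw [Finset.sum_insert hi])

theorem meromorphicAt_projFun_term {F : ℂ → ℂ} (hF : MeromorphicAt F 0) (s : K0) (n : ℕ) :
    MeromorphicAt (fun u => moments s n * ((n.factorial : ℂ)⁻¹ * deriv^[n] F u)) 0 :=
  (MeromorphicAt.const _ 0).mul ((MeromorphicAt.const _ 0).mul (meromorphicAt_iterate_deriv hF n))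

theorem meromorphicAt_projFun {F : ℂ → ℂ} (hF : MeromorphicAt F 0) (s : K0) :
    MeromorphicAt (projFun F s) 0 :=
  MeromorphicAt.fun_sum fun n _ => meromorphicAt_projFun_term hF s n

theorem proj_mk {F : ℂ → ℂ} (hF : MeromorphicAt F 0) (s : K0) :
    proj (K0.mk F hF) s = K0.mk (projFun F s) (meromorphicAt_projFun hF s) := by
  rw [proj_apply, Finsupp.sum]
  refine Eq.trans (Finset.sum_congr rfl fun n _ => ?_)
    (K0.mk_sum _ _ (meromorphicAt_projFun_term hF s) _).symm
  rw [K0.D_pow_mk, ← K0.mk_smul, ← K0.mk_smul]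

theorem projFun_const (k : ℂ) (s : K0) (u : ℂ) : projFun (fun _ => k) s u = K0.res s * k := by
  have h : ∀ n : ℕ, n ≠ 0 → deriv^[n] (fun _ : ℂ => k) u = 0 := fun n hn => by
    rw [← iteratedDeriv_eq_iterate, iteratedDeriv_const, if_neg hn]
  rw [projFun, Finset.sum_eq_single 0]
  · simp [moments_zero_apply]
  · intro n _ hn
    rw [h n hn, mul_zero, mul_zero]
  · intro h0
    rw [Finsupp.notMem_support_iff.1 h0, zero_mul]

theorem projFun_const_mul (c : ℂ) (F : ℂ → ℂ) (s : K0) (u : ℂ) :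
    projFun (fun u => c * F u) s u = c * projFun F s u := by
  rw [projFun, projFun, Finset.mul_sum]
  refine Finset.sum_congr rfl fun n _ => ?_
  rw [← iteratedDeriv_eq_iterate, ← iteratedDeriv_eq_iterate, iteratedDeriv_const_mul_field]
  ring

theorem IsQuasiPeriodic.projFun {τ : UpperHalfPlane} {χ : ℂ} {F G : ℂ → ℂ}
    (h : IsQuasiPeriodic τ χ F G) (s : K0) :
    IsQuasiPeriodic τ χ (projFun F s) (projFun G s) where
  analyticAt u hu := Finset.analyticAt_fun_sum _ fun n _ =>
    analyticAt_const.mul (analyticAt_const.mul ((h.iterate_deriv n).analyticAt u hu))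
  analyticAt_shift u hu := Finset.analyticAt_fun_sum _ fun n _ =>
    analyticAt_const.mul (analyticAt_const.mul ((h.iterate_deriv n).analyticAt_shift u hu))
  add_one u hu := Finset.sum_congr rfl fun n _ => by rw [(h.iterate_deriv n).add_one u hu]
  add_tau u hu := by
    rw [EllipticCurrent.projFun, EllipticCurrent.projFun, EllipticCurrent.projFun,
      ← Finset.sum_add_distrib, Finset.mul_sum]
    refine Finset.sum_congr rfl fun n _ => ?_
    rw [(h.iterate_deriv n).add_tau u hu]
    ring

/-- A function with removable singularities only extends to an entire function. -/
theorem exists_differentiable_of_removable {E : ℂ → ℂ}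
    (h : ∀ z, ∃ o : ℂ → ℂ, AnalyticAt ℂ o z ∧ E =ᶠ[𝓝[≠] z] o) :
    ∃ f : ℂ → ℂ, Differentiable ℂ f ∧ ∀ z, E =ᶠ[𝓝[≠] z] f := by
  choose o ho hE using h
  -- The local extensions coincide near each point, so their values at the centres fit together.
  have key : ∀ z, ∀ᶠ w in 𝓝 z, o w w = o z w := by
    intro z
    have h1 : ∀ᶠ w in 𝓝[≠] z, o w w = o z w := by
      filter_upwards [eventually_eventually_nhdsWithin.2 (hE z),
        (ho z).eventually_analyticAt.filter_mono nhdsWithin_le_nhds, self_mem_nhdsWithin]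
        with w h2 h3 hw
      have h4 : ∀ᶠ v in 𝓝[≠] w, E v = o z v := by
        rw [isOpen_compl_singleton.nhdsWithin_eq hw] at h2
        exact h2.filter_mono nhdsWithin_le_nhds
      have h5 : o w =ᶠ[𝓝[≠] w] o z := (hE w).symm.trans h4
      exact tendsto_nhds_unique_of_eventuallyEq
        ((ho w).continuousAt.continuousWithinAt) (h3.continuousAt.continuousWithinAt) h5
    rw [eventually_nhdsWithin_iff] at h1
    filter_upwards [h1] with w hw
    by_cases hwz : w = z
    · rw [hwz]
    · exact hw hwz
  refine ⟨fun z => o z z, fun z => ?_, fun z => ?_⟩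
  · exact ((ho z).congr ((key z).mono fun w hw => hw.symm)).differentiableAt
  · filter_upwards [hE z, (key z).filter_mono nhdsWithin_le_nhds] with w h1 h2
    rw [h1, h2]

theorem eq_of_eventuallyEq_nhdsNE {f g : ℂ → ℂ} (hf : Continuous f) (hg : Continuous g) {z : ℂ}
    (h : f =ᶠ[𝓝[≠] z] g) : f z = g z :=
  tendsto_nhds_unique_of_eventuallyEq (hf.continuousAt.continuousWithinAt)
    (hg.continuousAt.continuousWithinAt) h

/-- Liouville's theorem for doubly periodic functions. -/
theorem eq_of_doubly_periodic (τ : UpperHalfPlane) {f : ℂ → ℂ} (hf : Differentiable ℂ f)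
    (h1 : Function.Periodic f 1) (h2 : Function.Periodic f τ) (z w : ℂ) : f z = f w := by
  refine hf.apply_eq_apply_of_bounded ?_ z w
  have hK : IsCompact ((fun p : ℝ × ℝ => f (p.1 + p.2 * τ)) '' (Set.Icc 0 1 ×ˢ Set.Icc 0 1)) :=
    (isCompact_Icc.prod isCompact_Icc).image (by
      have := hf.continuous
      fun_prop)
  refine hK.isBounded.subset ?_
  rintro _ ⟨u, rfl⟩
  set b : ℝ := u.im / τ.im with hb
  set a : ℝ := u.re - b * τ.re with ha
  have hu : u = a + b * τ := by
    have := τ.im_pos.ne'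
    apply Complex.ext
    · simp [ha]
    · simp [hb]
      field_simp
  refine ⟨(Int.fract a, Int.fract b), ⟨⟨Int.fract_nonneg a, (Int.fract_lt_one a).le⟩,
    ⟨Int.fract_nonneg b, (Int.fract_lt_one b).le⟩⟩, ?_⟩
  have hp := (h1.int_mul ⌊a⌋).add_period (h2.int_mul ⌊b⌋)
  refine (hp _).symm.trans (congrArg f ?_)
  rw [hu, Int.fract, Int.fract]
  push_cast
  ring

section Elliptic

variable (τ : UpperHalfPlane)

theorem deriv_theta_add_tau (u : ℂ) : deriv (theta τ) (u + τ) =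
    -Complex.exp (-(2 * Real.pi * Complex.I * u) - Real.pi * Complex.I * τ) *
      (deriv (theta τ) u - 2 * Real.pi * Complex.I * theta τ u) := by
  have h := (isOddTheta_theta τ.im_pos).add_tau
  rw [← deriv_comp_add_const, funext h]
  have h1 : HasDerivAt (fun u : ℂ => -Complex.exp (-(2 * Real.pi * Complex.I * u) -
      Real.pi * Complex.I * τ)) (-(Complex.exp (-(2 * Real.pi * Complex.I * u) -
      Real.pi * Complex.I * τ) * -(2 * Real.pi * Complex.I))) u := by
    refine HasDerivAt.neg (HasDerivAt.cexp ?_)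
    simpa using (((hasDerivAt_id u).const_mul (2 * Real.pi * Complex.I)).neg).sub_const
      (Real.pi * Complex.I * (τ : ℂ))
  refine (h1.mul (differentiable_theta τ u).hasDerivAt).deriv.trans ?_
  ring

theorem deriv_theta_add_one (u : ℂ) : deriv (theta τ) (u + 1) = -deriv (theta τ) u := by
  rw [← deriv_comp_add_const, funext (isOddTheta_theta τ.im_pos).add_one, deriv.fun_neg]

theorem analyticAt_comp_add {f : ℂ → ℂ} (hf : Differentiable ℂ f) (lam u : ℂ) :
    AnalyticAt ℂ (fun u => f (u + lam)) u := by
  have : Differentiable ℂ fun u => f (u + lam) := hf.comp (by fun_prop)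
  exact this.analyticAt u

theorem isQuasiPeriodic_green_zero :
    IsQuasiPeriodic τ 1 (green τ 0) (fun _ => -(2 * Real.pi * Complex.I)) where
  analyticAt u hu := by
    have : green τ 0 = fun u => deriv (theta τ) u / theta τ u := by
      ext u; simp [green]
    rw [this]
    have h := (differentiable_theta τ).analyticAt u
    exact h.deriv.div h hu
  analyticAt_shift u hu := analyticAt_const
  add_one u hu := by
    simp [green, deriv_theta_add_one, (isOddTheta_theta τ.im_pos).add_one]
  add_tau u hu := by
    simp only [green, if_true, deriv_theta_add_tau, (isOddTheta_theta τ.im_pos).add_tau]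
    have := Complex.exp_ne_zero (-(2 * Real.pi * Complex.I * u) - Real.pi * Complex.I * τ)
    field_simp
    ring

theorem isQuasiPeriodic_green {lam : ℂ} (hlam : theta τ lam ≠ 0) :
    IsQuasiPeriodic τ (Complex.exp (-(2 * Real.pi * Complex.I * lam))) (green τ lam)
      (fun _ => 0) where
  analyticAt u hu := by
    have h0 : lam ≠ 0 := fun h => hlam (h ▸ theta_zero τ)
    have : green τ lam = fun u => theta τ (u + lam) / (theta τ u * theta τ lam) := by
      ext u; simp [green, h0]
    rw [this]
    exact (analyticAt_comp_add (differentiable_theta τ) lam u).div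
      (((differentiable_theta τ).analyticAt u).mul analyticAt_const) (mul_ne_zero hu hlam)
  analyticAt_shift u hu := analyticAt_const
  add_one u hu := by
    have h0 : lam ≠ 0 := fun h => hlam (h ▸ theta_zero τ)
    have e : u + 1 + lam = u + lam + 1 := by ring
    simp [green, h0, e, (isOddTheta_theta τ.im_pos).add_one, neg_div_neg_eq]
  add_tau u hu := by
    have h0 : lam ≠ 0 := fun h => hlam (h ▸ theta_zero τ)
    have e : u + τ + lam = u + lam + τ := by ring
    have e2 : Complex.exp (-(2 * Real.pi * Complex.I * (u + lam)) - Real.pi * Complex.I * τ) =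
        Complex.exp (-(2 * Real.pi * Complex.I * lam)) *
          Complex.exp (-(2 * Real.pi * Complex.I * u) - Real.pi * Complex.I * τ) := by
      rw [← Complex.exp_add]; congr 1; ring
    simp only [green, if_neg h0, e, (isOddTheta_theta τ.im_pos).add_tau, e2]
    have := Complex.exp_ne_zero (-(2 * Real.pi * Complex.I * u) - Real.pi * Complex.I * τ)
    field_simp
    ring

/-- The residue theorem: an elliptic function with poles only at the lattice points has residue
zero. Subtracting a combination of the derivatives of `θ'/θ` removes the poles, and leaves an entire
function `f` with `f(u + 1) = f(u)` whose increment under `u ↦ u + τ` is `2πi` times the residue.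
By Liouville's theorem `f` is an affine function, hence constant. -/
theorem residue_eq_zero_of_elliptic {F : ℂ → ℂ} (hm : MeromorphicAt F 0)
    (hF : IsQuasiPeriodic τ 1 F (fun _ => 0)) : residue F = 0 := by
  set s := K0.mk F hm with hs
  set c : ℂ := K0.res s * (2 * Real.pi * Complex.I) with hc
  set G := projFun (green τ 0) s with hG
  have hGq := (isQuasiPeriodic_green_zero τ).projFun s
  obtain ⟨o, ho, hso⟩ := (isSimplePole_greenGerm τ (Or.inl rfl)).sub_proj_mem s
  set E : ℂ → ℂ := fun u => F u - G u with hE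
  have hE1 : ∀ u, theta τ u ≠ 0 → E (u + 1) = E u := fun u hu => by
    simp only [hE, hF.add_one u hu, hG, hGq.add_one u hu]
  have hE2 : ∀ u, theta τ u ≠ 0 → E (u + τ) = E u + c := fun u hu => by
    simp only [hE, hF.add_tau u hu, hG, hGq.add_tau u hu, projFun_const, hc]
    ring
  have hE0 : E =ᶠ[𝓝[≠] 0] o := by
    rw [greenGerm, proj_mk] at hso
    exact (K0.mk_eq_iff (hm.sub (meromorphicAt_projFun (meromorphicAt_green τ 0) s)) _).1 hso
  -- The translations under which `E` changes by a constant form a group containing the lattice.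
  let H : AddSubgroup ℂ :=
    { carrier := {γ | (∀ u, theta τ (u + γ) = 0 ↔ theta τ u = 0) ∧
        ∃ k, ∀ u, theta τ u ≠ 0 → E (u + γ) = E u + k}
      zero_mem' := ⟨by simp, 0, by simp⟩
      add_mem' := by
        rintro γ γ' ⟨h1, k, hk⟩ ⟨h1', k', hk'⟩
        refine ⟨fun u => by rw [← add_assoc, h1', h1], k + k', fun u hu => ?_⟩
        rw [← add_assoc, hk' _ (mt (h1 u).1 hu), hk u hu, add_assoc]
      neg_mem' := by
        rintro γ ⟨h1, k, hk⟩
        have h2 : ∀ u, theta τ (u + -γ) = 0 ↔ theta τ u = 0 := fun u => by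
          rw [← h1, neg_add_cancel_right]
        refine ⟨h2, -k, fun u hu => ?_⟩
        have := hk (u + -γ) (mt (h2 u).1 hu)
        rw [neg_add_cancel_right] at this
        rw [this, add_neg_cancel_right] }
  have hH : ∀ z, theta τ z = 0 → z ∈ H := fun z hz => by
    have : z ∈ lattice τ := by_contra fun h => theta_ne_zero τ h hz
    obtain ⟨m, n, rfl⟩ := this
    have h1 : (1 : ℂ) ∈ H := ⟨theta_add_one_eq_zero_iff τ, 0, by simpa using hE1⟩
    have h2 : (τ : ℂ) ∈ H := ⟨theta_add_tau_eq_zero_iff τ, c, hE2⟩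
    simpa using H.add_mem (H.zsmul_mem h1 m) (H.zsmul_mem h2 n)
  obtain ⟨f, hf, hfE⟩ : ∃ f : ℂ → ℂ, Differentiable ℂ f ∧ ∀ z, E =ᶠ[𝓝[≠] z] f := by
    refine exists_differentiable_of_removable fun z => ?_
    by_cases hz : theta τ z = 0
    · obtain ⟨h1, k, hk⟩ := hH z hz
      have ht : Tendsto (fun u => u - z) (𝓝[≠] z) (𝓝[≠] 0) := by
        refine tendsto_nhdsWithin_iff.2 ⟨?_, ?_⟩
        · have : ContinuousAt (fun u : ℂ => u - z) z := by fun_prop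
          have h := this.tendsto
          rw [sub_self] at h
          exact h.mono_left nhdsWithin_le_nhds
        · filter_upwards [self_mem_nhdsWithin] with u hu
          exact sub_ne_zero.2 hu
      refine ⟨fun u => o (u - z) + k, AnalyticAt.add ?_ analyticAt_const, ?_⟩
      · refine AnalyticAt.fun_comp (g := o) ?_ (analyticAt_id.sub analyticAt_const)
        simpa using ho
      · filter_upwards [ht.eventually hE0, ht.eventually (eventually_theta_ne_zero τ 0)]
          with u h2 h3
        rw [← h2, ← hk _ h3, sub_add_cancel]
    · exact ⟨E, (hF.analyticAt z hz).sub (hGq.analyticAt z hz), EventuallyEq.rfl⟩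
  have hEf : ∀ u, theta τ u ≠ 0 → E u = f u := fun u hu => by
    have h1 : ContinuousAt E u := ((hF.analyticAt u hu).sub (hGq.analyticAt u hu)).continuousAt
    exact tendsto_nhds_unique_of_eventuallyEq h1.continuousWithinAt
      (hf.continuous.continuousAt.continuousWithinAt) (hfE u)
  have hf1 : ∀ u, f (u + 1) = f u := fun u => by
    refine eq_of_eventuallyEq_nhdsNE (f := fun u => f (u + 1)) (z := u)
      (hf.continuous.comp (by fun_prop)) hf.continuous ?_
    filter_upwards [eventually_theta_ne_zero τ u] with w hw
    rw [← hEf w hw, ← hE1 w hw, hEf _ (mt (theta_add_one_eq_zero_iff τ w).1 hw)]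
  have hf2 : ∀ u, f (u + τ) = f u + c := fun u => by
    refine eq_of_eventuallyEq_nhdsNE (f := fun u => f (u + τ)) (g := fun u => f u + c) (z := u)
      (hf.continuous.comp (by fun_prop)) (hf.continuous.add continuous_const) ?_
    filter_upwards [eventually_theta_ne_zero τ u] with w hw
    rw [← hEf w hw, ← hE2 w hw, hEf _ (mt (theta_add_tau_eq_zero_iff τ w).1 hw)]
  have hd : ∀ z, deriv f z = deriv f 0 := fun z => by
    refine eq_of_doubly_periodic τ ?_ (fun u => ?_) (fun u => ?_) z 0
    · exact fun u => (hf.analyticAt u).deriv.differentiableAt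
    · rw [← deriv_comp_add_const, funext hf1]
    · rw [← deriv_comp_add_const, funext hf2, deriv_add_const]
  have hc' : ∀ z, f z - deriv f 0 * z = f 0 := fun z => by
    have hd' : Differentiable ℂ fun z => f z - deriv f 0 * z := hf.sub (by fun_prop)
    have := is_const_of_deriv_eq_zero hd' (fun w => by
      have h1 := (hf w).hasDerivAt.sub ((hasDerivAt_id w).const_mul (deriv f 0))
      rw [mul_one, hd w, sub_self] at h1
      exact h1.deriv) z 0
    simpa using this
  have h1 : deriv f 0 = 0 := by
    have := hc' (0 + 1)
    rw [hf1] at this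
    simpa using this
  have h2 := hc' (0 + τ)
  rw [hf2, h1, zero_mul, sub_zero, add_eq_left, hc] at h2
  exact (mul_eq_zero.1 h2).resolve_right Complex.two_pi_I_ne_zero

end Elliptic

/-! ### Differentiation with respect to the parameter -/

theorem analyticAt_iterate_deriv {o : ℂ → ℂ} {z : ℂ} (ho : AnalyticAt ℂ o z) (n : ℕ) :
    AnalyticAt ℂ (deriv^[n] o) z := by
  induction n with
  | zero => exact ho
  | succ n ih => rw [Function.iterate_succ_apply']; exact ih.deriv

/-- The residue of a product with a holomorphic factor depends on finitely many Taylor coefficients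
of this factor only. -/
theorem res_mk_mul {o : ℂ → ℂ} (ho : AnalyticAt ℂ o 0) (w : K0) :
    K0.res (K0.mk o ho.meromorphicAt * w) =
      (moments w).sum fun n a => a * ((n.factorial : ℂ)⁻¹ * ((-1) ^ n * deriv^[n] o 0)) := by
  have h := res_regular (mul_mem (isSimplePole_coordInv.sub_proj_mem w)
    (show K0.mk o ho.meromorphicAt ∈ regular from ⟨o, ho, rfl⟩))
  rw [sub_mul, map_sub, sub_eq_zero, res_proj_mul] at h
  rw [mul_comm, h]
  refine Finset.sum_congr rfl fun n _ => ?_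
  beta_reduce
  rw [mul_comm ((K0.D ^ n) coordInv), res_mul_D_pow, K0.D_pow_mk,
    res_mul_coordInv (analyticAt_iterate_deriv ho n)]

theorem hasDerivAt_res_comp_add {f : ℂ → ℂ} (hf : Differentiable ℂ f)
    (hf' : Differentiable ℂ (deriv f)) (w : K0) (lam : ℂ) :
    HasDerivAt
      (fun l => K0.res (K0.mk (fun u => f (u + l)) (analyticAt_comp_add hf l 0).meromorphicAt * w))
      (K0.res (K0.mk (fun u => deriv f (u + lam))
        (analyticAt_comp_add hf' lam 0).meromorphicAt * w)) lam := by
  simp only [res_mk_mul (analyticAt_comp_add hf _ 0), res_mk_mul (analyticAt_comp_add hf' lam 0)]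
  refine HasDerivAt.fun_sum fun n _ => ?_
  refine (HasDerivAt.const_mul _ ?_).const_mul _ |>.const_mul _
  simp only [← iteratedDeriv_eq_iterate, iteratedDeriv_comp_add_const, zero_add]
  rw [iteratedDeriv_eq_iterate, iteratedDeriv_eq_iterate, ← Function.iterate_succ_apply,
    Function.iterate_succ_apply']
  exact (analyticAt_iterate_deriv (hf.analyticAt lam) n).differentiableAt.hasDerivAt

section Dot

variable (τ : UpperHalfPlane)

theorem differentiable_deriv_theta : Differentiable ℂ (deriv (theta τ)) :=
  fun u => ((differentiable_theta τ).analyticAt u).deriv.differentiableAt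

/-- The derivative of `θ(u+λ) / (θ(u) θ(λ))` with respect to `λ`. -/
def greenDot (lam u : ℂ) : ℂ :=
  (theta τ lam)⁻¹ * (deriv (theta τ) (u + lam) * (theta τ u)⁻¹) +
    -(deriv (theta τ) lam / theta τ lam ^ 2) * (theta τ (u + lam) * (theta τ u)⁻¹)

theorem meromorphicAt_theta_inv : MeromorphicAt (fun u => (theta τ u)⁻¹) 0 :=
  ((differentiable_theta τ).analyticAt 0).meromorphicAt.inv

theorem meromorphicAt_greenDot (lam : ℂ) : MeromorphicAt (greenDot τ lam) 0 :=
  ((MeromorphicAt.const _ 0).mul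
    ((analyticAt_comp_add (differentiable_deriv_theta τ) lam 0).meromorphicAt.mul
      (meromorphicAt_theta_inv τ))).add
  ((MeromorphicAt.const _ 0).mul
    ((analyticAt_comp_add (differentiable_theta τ) lam 0).meromorphicAt.mul
      (meromorphicAt_theta_inv τ)))

/-- The germ of `greenDot τ lam`. -/
def greenDotGerm (lam : ℂ) : K0 := K0.mk (greenDot τ lam) (meromorphicAt_greenDot τ lam)

theorem eventually_theta_ne_zero_of_ne {lam : ℂ} (h : theta τ lam ≠ 0) :
    ∀ᶠ l in 𝓝 lam, l ≠ 0 ∧ theta τ l ≠ 0 := by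
  filter_upwards [eventually_nhds_theta_ne_zero τ h] with l hl
  exact ⟨fun h0 => hl (h0 ▸ theta_zero τ), hl⟩

theorem theta_neg_ne_zero {lam : ℂ} (h : theta τ lam ≠ 0) : theta τ (-lam) ≠ 0 := by
  rw [(isOddTheta_theta τ.im_pos).odd]
  exact neg_ne_zero.2 h

theorem hasDerivAt_res_green {lam : ℂ} (h : theta τ lam ≠ 0) (t : K0) :
    HasDerivAt (fun l => K0.res (greenGerm τ l * t)) (K0.res (greenDotGerm τ lam * t)) lam := by
  set v : K0 := K0.mk (fun u => (theta τ u)⁻¹) (meromorphicAt_theta_inv τ) with hv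
  have h1 := hasDerivAt_res_comp_add (differentiable_theta τ) (differentiable_deriv_theta τ)
    (v * t) lam
  have h2 := (differentiable_theta τ lam).hasDerivAt.inv h
  have h3 := h2.mul h1
  refine (h3.congr_of_eventuallyEq ?_).congr_deriv ?_
  · filter_upwards [eventually_theta_ne_zero_of_ne τ h] with l hl
    have e : greenGerm τ l = (theta τ l)⁻¹ • (K0.mk (fun u => theta τ (u + l))
        (analyticAt_comp_add (differentiable_theta τ) l 0).meromorphicAt * v) := by
      rw [hv, ← K0.mk_mul, ← K0.mk_smul]
      refine K0.mk_congr _ _ (funext fun u => ?_)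
      rw [green, if_neg hl.1]
      ring
    rw [e, smul_mul_assoc, map_smul, mul_assoc, smul_eq_mul]
    rfl
  · have e : greenDotGerm τ lam = (theta τ lam)⁻¹ • (K0.mk (fun u => deriv (theta τ) (u + lam))
        (analyticAt_comp_add (differentiable_deriv_theta τ) lam 0).meromorphicAt * v) +
        (-(deriv (theta τ) lam / theta τ lam ^ 2)) • (K0.mk (fun u => theta τ (u + lam))
        (analyticAt_comp_add (differentiable_theta τ) lam 0).meromorphicAt * v) := rfl
    rw [e, add_mul, smul_mul_assoc, smul_mul_assoc, map_add, map_smul, map_smul, mul_assoc,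
      mul_assoc, smul_eq_mul, smul_eq_mul]
    simp only [Pi.inv_apply]
    ring

/-- The pole of `θ(u+λ) / (θ(u) θ(λ))` at the origin does not depend on `λ`. -/
theorem greenDotGerm_mem_regular {lam : ℂ} (h : theta τ lam ≠ 0) :
    greenDotGerm τ lam ∈ regular := by
  refine mem_regular_of_moments fun n => ?_
  have h1 := hasDerivAt_res_green τ h ((-coord) ^ n)
  have h2 : HasDerivAt (fun l => K0.res (greenGerm τ l * (-coord) ^ n)) 0 lam := by
    refine (hasDerivAt_const lam (if n = 0 then (1 : ℂ) else 0)).congr_of_eventuallyEq ?_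
    filter_upwards [eventually_nhds_theta_ne_zero τ h] with l hl
    have := (isSimplePole_greenGerm τ (Or.inr hl)).res_pow_mul_D_pow n 0
    rw [pow_zero, Module.End.one_apply] at this
    rw [mul_comm, this]
    simp
  rw [mul_comm]
  exact h1.unique h2

theorem hasDerivAt_res_proj {lam : ℂ} (h : theta τ lam ≠ 0) (s t : K0) :
    HasDerivAt (fun l => K0.res (proj (greenGerm τ l) s * t))
      (K0.res (proj (greenDotGerm τ lam) s * t)) lam := by
  simp only [res_proj_mul]
  refine HasDerivAt.fun_sum fun n _ => ?_
  refine HasDerivAt.const_mul _ (HasDerivAt.const_mul _ ?_)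
  have e : ∀ g : K0, K0.res ((K0.D ^ n) g * t) = (-1) ^ n * K0.res (g * (K0.D ^ n) t) := fun g => by
    rw [res_mul_D_pow, ← mul_assoc, ← mul_pow]
    simp
  simp only [e]
  exact (hasDerivAt_res_green τ h _).const_mul _

theorem hasDerivAt_res_proj_neg {lam : ℂ} (h : theta τ lam ≠ 0) (s t : K0) :
    HasDerivAt (fun l => K0.res (proj (greenGerm τ (-l)) s * t))
      (-K0.res (proj (greenDotGerm τ (-lam)) s * t)) lam := by
  have h1 := hasDerivAt_res_proj τ (theta_neg_ne_zero τ h) s t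
  have h2 := h1.scomp lam (hasDerivAt_neg lam)
  rw [neg_smul, one_smul] at h2
  exact h2

theorem res_proj_add {lam : ℂ} (h : lam = 0 ∨ theta τ lam ≠ 0) (s t : K0) :
    K0.res (proj (greenGerm τ lam) s * proj (greenGerm τ (-lam)) t) = 0 ∧
      K0.res (proj (greenGerm τ lam) s * t) + K0.res (s * proj (greenGerm τ (-lam)) t) =
        K0.res (s * t) :=
  (isSimplePole_greenGerm τ h).res_proj_add
    (isSimplePole_greenGerm τ (h.imp (fun h => by rw [h, neg_zero]) (theta_neg_ne_zero τ)))
    (res_green_mul_green τ lam) s t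

/-- The derivative of the adjointness of the projections. -/
theorem res_proj_greenDot {lam : ℂ} (h : theta τ lam ≠ 0) (s t : K0) :
    K0.res (proj (greenDotGerm τ lam) s * t) = K0.res (proj (greenDotGerm τ (-lam)) t * s) := by
  have h1 := (hasDerivAt_res_proj τ h s t).add (hasDerivAt_res_proj_neg τ h t s)
  have h2 : HasDerivAt (fun _ : ℂ => K0.res (s * t)) 0 lam := hasDerivAt_const _ _
  have h3 := h1.unique (h2.congr_of_eventuallyEq (by
    filter_upwards [eventually_nhds_theta_ne_zero τ h] with l hl
    rw [← (res_proj_add τ (Or.inr hl) s t).2, mul_comm s]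
    rfl))
  linear_combination h3

theorem isQuasiPeriodic_greenDot {lam : ℂ} (hlam : theta τ lam ≠ 0) :
    IsQuasiPeriodic τ (Complex.exp (-(2 * Real.pi * Complex.I * lam))) (greenDot τ lam)
      (fun u => -(2 * Real.pi * Complex.I) * green τ lam u) where
  analyticAt u hu :=
    (analyticAt_const.mul ((analyticAt_comp_add (differentiable_deriv_theta τ) lam u).mul
      (((differentiable_theta τ).analyticAt u).inv hu))).add
    (analyticAt_const.mul ((analyticAt_comp_add (differentiable_theta τ) lam u).mul
      (((differentiable_theta τ).analyticAt u).inv hu)))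
  analyticAt_shift u hu := analyticAt_const.mul ((isQuasiPeriodic_green τ hlam).analyticAt u hu)
  add_one u hu := by
    have e : u + 1 + lam = u + lam + 1 := by ring
    simp [greenDot, e, (isOddTheta_theta τ.im_pos).add_one, deriv_theta_add_one, inv_neg]
  add_tau u hu := by
    have h0 : lam ≠ 0 := fun h => hlam (h ▸ theta_zero τ)
    have e : u + τ + lam = u + lam + τ := by ring
    have e2 : Complex.exp (-(2 * Real.pi * Complex.I * (u + lam)) - Real.pi * Complex.I * τ) =
        Complex.exp (-(2 * Real.pi * Complex.I * lam)) *
          Complex.exp (-(2 * Real.pi * Complex.I * u) - Real.pi * Complex.I * τ) := by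
      rw [← Complex.exp_add]; congr 1; ring
    simp only [greenDot, green, if_neg h0, e, (isOddTheta_theta τ.im_pos).add_tau,
      deriv_theta_add_tau, e2]
    have := Complex.exp_ne_zero (-(2 * Real.pi * Complex.I * u) - Real.pi * Complex.I * τ)
    field_simp
    ring

/-- The increment of the first factor under the translation by `τ` is the constant
`-2πi Res a`, and that of the derivative of the second factor is `-2πi` times this factor. So the
difference of the two sides is the residue of an elliptic function. -/
theorem res_proj_mul_proj_mul_proj {lam : ℂ} (hlam : theta τ lam ≠ 0) (a b c : K0) :
    K0.res (proj (greenGerm τ 0) a * proj (greenGerm τ (-lam)) b * proj (greenGerm τ lam) c) =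
      K0.res a * K0.res (proj (greenDotGerm τ (-lam)) b * c) := by
  have hlam' := theta_neg_ne_zero τ hlam
  have hA := (isQuasiPeriodic_green_zero τ).projFun a
  have hB := (isQuasiPeriodic_green τ hlam').projFun b
  have hB' := (isQuasiPeriodic_greenDot τ hlam').projFun b
  have hC := (isQuasiPeriodic_green τ hlam).projFun c
  have mA := meromorphicAt_projFun (meromorphicAt_green τ 0) a
  have mB := meromorphicAt_projFun (meromorphicAt_green τ (-lam)) b
  have mB' := meromorphicAt_projFun (meromorphicAt_greenDot τ (-lam)) b
  have mC := meromorphicAt_projFun (meromorphicAt_green τ lam) c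
  have hχ : Complex.exp (-(2 * Real.pi * Complex.I * -lam)) *
      Complex.exp (-(2 * Real.pi * Complex.I * lam)) = 1 := by
    rw [← Complex.exp_add]; simp
  -- The terms with `2πi` cancel under the translation by `τ`.
  have h := residue_eq_zero_of_elliptic τ (((mA.mul mB).mul mC).add
    ((MeromorphicAt.const (-K0.res a) 0).mul (mB'.mul mC))) (by
    refine ⟨fun u hu => ?_, fun u hu => analyticAt_const, fun u hu => ?_, fun u hu => ?_⟩
    · exact (((hA.analyticAt u hu).mul (hB.analyticAt u hu)).mul (hC.analyticAt u hu)).add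
        (analyticAt_const.mul ((hB'.analyticAt u hu).mul (hC.analyticAt u hu)))
    · simp only [Pi.add_apply, Pi.mul_apply, hA.add_one u hu, hB.add_one u hu, hB'.add_one u hu,
        hC.add_one u hu]
    · simp only [Pi.add_apply, Pi.mul_apply, hA.add_tau u hu, hB.add_tau u hu, hB'.add_tau u hu,
        hC.add_tau u hu, projFun_const, projFun_const_mul]
      linear_combination (projFun (green τ 0) a u * projFun (green τ (-lam)) b u *
        projFun (green τ lam) c u - K0.res a * (projFun (greenDot τ (-lam)) b u *
        projFun (green τ lam) c u)) * hχ)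
  have e : K0.res (proj (greenGerm τ 0) a * proj (greenGerm τ (-lam)) b * proj (greenGerm τ lam) c +
      (-K0.res a) • (proj (greenDotGerm τ (-lam)) b * proj (greenGerm τ lam) c)) = 0 := by
    rw [greenGerm, greenGerm, greenGerm, greenDotGerm, proj_mk, proj_mk, proj_mk, proj_mk]
    exact h
  have h2 := res_regular (mul_mem (proj_mem_regular (greenDotGerm_mem_regular τ hlam') b)
    ((isSimplePole_greenGerm τ (Or.inr hlam)).sub_proj_mem c))
  rw [mul_sub, map_sub] at h2
  rw [map_add, map_smul, smul_eq_mul] at e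
  linear_combination e - K0.res a * h2

end Dot

open CurrentAlgebra

/-! ### Duality of the bases -/

theorem epsUp_ofNat (τ : UpperHalfPlane) (lam : ℂ) (n : ℕ) :
    epsUp τ lam n = ((n.factorial : ℂ)⁻¹) • (K0.D ^ n) (greenGerm τ lam) := rfl

theorem epsUp_negSucc (τ : UpperHalfPlane) (lam : ℂ) (n : ℕ) :
    epsUp τ lam (Int.negSucc n) = coord ^ n := rfl

theorem epsDown_ofNat (τ : UpperHalfPlane) (lam : ℂ) (n : ℕ) :
    epsDown τ lam n = (-coord) ^ n := rfl

theorem epsDown_negSucc (τ : UpperHalfPlane) (lam : ℂ) (n : ℕ) :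
    epsDown τ lam (Int.negSucc n) =
      ((-1 : ℂ) ^ n * (n.factorial : ℂ)⁻¹) • (K0.D ^ n) (greenGerm τ (-lam)) := rfl

theorem res_epsUp_mul_epsDown (τ : UpperHalfPlane) {lam : ℂ} (h : lam = 0 ∨ theta τ lam ≠ 0)
    (n m : ℤ) : K0.res (epsUp τ lam n * epsDown τ lam m) = if n = m then 1 else 0 := by
  have h' : -lam = 0 ∨ theta τ (-lam) ≠ 0 :=
    h.imp (fun h => by rw [h, neg_zero]) (theta_neg_ne_zero τ)
  obtain n | n := n <;> obtain m | m := m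
  · rw [Int.ofNat_eq_natCast, Int.ofNat_eq_natCast, epsUp_ofNat, epsDown_ofNat, smul_mul_assoc,
      map_smul, mul_comm, (isSimplePole_greenGerm τ h).res_pow_mul_D_pow]
    by_cases hnm : n = m
    · simp [hnm, Nat.factorial_ne_zero]
    · simp [hnm, Ne.symm hnm]
  · rw [Int.ofNat_eq_natCast, epsUp_ofNat, epsDown_negSucc, smul_mul_assoc, mul_smul_comm, map_smul,
      map_smul, res_green_mul_green]
    simp
  · rw [Int.ofNat_eq_natCast, epsUp_negSucc, epsDown_ofNat, res_regular]
    · simp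
    · exact mul_mem (pow_mem coord_mem_regular n) (pow_mem (neg_mem coord_mem_regular) m)
  · have e : K0.res (coord ^ n * (K0.D ^ m) (greenGerm τ (-lam))) =
        (-1) ^ n * K0.res ((-coord) ^ n * (K0.D ^ m) (greenGerm τ (-lam))) := by
      rw [res_neg_coord_pow_mul, ← mul_assoc, ← mul_pow]
      simp
    rw [epsUp_negSucc, epsDown_negSucc, mul_smul_comm, map_smul, e,
      (isSimplePole_greenGerm τ h').res_pow_mul_D_pow]
    by_cases hnm : n = m
    · subst hnm
      have : ((-1 : ℂ) ^ n) * (-1) ^ n = 1 := by rw [← mul_pow]; simp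
      have h2 : (n.factorial : ℂ) ≠ 0 := by exact_mod_cast Nat.factorial_ne_zero n
      simp only [if_true, smul_eq_mul]
      field_simp
      linear_combination this
    · simp [hnm]

/-! ### The splitting of the current algebra -/

namespace CurrentAlgebra

theorem form_eq (x y : CurrentAlgebra) : form x y =
    2 * K0.res (x.h * y.h) + K0.res (x.e * y.f) + K0.res (x.f * y.e) + x.c * y.d + x.d * y.c := by
  rw [form_apply, map_add, map_add, map_smul, smul_eq_mul]

theorem form_hh (s : K0) (y : CurrentAlgebra) : form (hh s) y = 2 * K0.res (s * y.h) := by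
  simp [form_eq, hh]

theorem form_ee (s : K0) (y : CurrentAlgebra) : form (ee s) y = K0.res (s * y.f) := by
  simp [form_eq, ee]

theorem form_ff (s : K0) (y : CurrentAlgebra) : form (ff s) y = K0.res (s * y.e) := by
  simp [form_eq, ff]

theorem form_dd (y : CurrentAlgebra) : form dd y = y.c := by
  simp [form_eq, dd]

end CurrentAlgebra

/-- The projection of the current algebra onto the span of the first factors of the universal
r-matrix, whose kernel is spanned by `d` and the `x ⊗ s` with `s` regular. -/
def polarPart (τ : UpperHalfPlane) (lam : ℂ) : CurrentAlgebra →ₗ[ℂ] CurrentAlgebra where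
  toFun x := ⟨proj (greenGerm τ 0) x.h, proj (greenGerm τ (-lam)) x.e, proj (greenGerm τ lam) x.f,
    x.c, 0⟩
  map_add' x y := by ext <;> simp
  map_smul' a x := by ext <;> simp

section PolarPart

variable (τ : UpperHalfPlane) (lam : ℂ) (x y : CurrentAlgebra)

theorem polarPart_h : (polarPart τ lam x).h = proj (greenGerm τ 0) x.h := rfl
theorem polarPart_e : (polarPart τ lam x).e = proj (greenGerm τ (-lam)) x.e := rfl
theorem polarPart_f : (polarPart τ lam x).f = proj (greenGerm τ lam) x.f := rfl
theorem polarPart_c : (polarPart τ lam x).c = x.c := rfl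
theorem polarPart_d : (polarPart τ lam x).d = 0 := rfl

theorem form_polarPart : form (polarPart τ lam x) y =
    2 * K0.res (proj (greenGerm τ 0) x.h * y.h) + K0.res (proj (greenGerm τ (-lam)) x.e * y.f) +
      K0.res (proj (greenGerm τ lam) x.f * y.e) + x.c * y.d := by
  simp [form_eq, polarPart_h, polarPart_e, polarPart_f, polarPart_c, polarPart_d]

end PolarPart

theorem isIsotropicSplitting_polarPart (τ : UpperHalfPlane) {lam : ℂ} (h : theta τ lam ≠ 0) :
    IsIsotropicSplitting form (polarPart τ lam) where
  symm := form_symm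
  invariant := form_invariant
  nondegenerate _ := form_nondegenerate
  isotropic x y := by
    have h0 := (res_proj_add τ (Or.inl rfl) x.h y.h).1
    have h1 := (res_proj_add τ (Or.inr h) x.f y.e).1
    have h2 := (res_proj_add τ (Or.inr h) y.f x.e).1
    rw [neg_zero] at h0
    rw [mul_comm] at h2
    simp [form_polarPart, polarPart_h, polarPart_e, polarPart_f, polarPart_d, h0, h1, h2]
  adjoint x y := by
    have h0 := (res_proj_add τ (Or.inl rfl) x.h y.h).2
    have h1 := (res_proj_add τ (Or.inr h) x.f y.e).2
    have h2 := (res_proj_add τ (Or.inr h) y.f x.e).2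
    rw [neg_zero] at h0
    rw [form_symm x, form_polarPart, form_polarPart, form_eq]
    rw [mul_comm x.h (proj _ _)] at h0
    rw [mul_comm x.f (proj _ _)] at h1
    rw [mul_comm y.f (proj _ _), mul_comm y.f x.e] at h2
    linear_combination 2 * h0 + h1 + h2
  closed x y := by
    have hr : ∀ z : CurrentAlgebra, (z - polarPart τ lam z).h ∈ regular ∧
        (z - polarPart τ lam z).e ∈ regular ∧ (z - polarPart τ lam z).f ∈ regular := fun z =>
      ⟨(isSimplePole_greenGerm τ (Or.inl rfl)).sub_proj_mem _,
        (isSimplePole_greenGerm τ (Or.inr (theta_neg_ne_zero τ h))).sub_proj_mem _,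
        (isSimplePole_greenGerm τ (Or.inr h)).sub_proj_mem _⟩
    obtain ⟨xh, xe, xf⟩ := hr x
    obtain ⟨yh, ye, yf⟩ := hr y
    generalize x - polarPart τ lam x = p at *
    generalize y - polarPart τ lam y = q at *
    ext
    · refine proj_of_mem_regular _ (add_mem (sub_mem (mul_mem xe yf) (mul_mem xf ye)) (sub_mem
        (Subalgebra.smul_mem _ (D_mem_regular yh) _) (Subalgebra.smul_mem _ (D_mem_regular xh) _)))
    · refine proj_of_mem_regular _ (add_mem (Subalgebra.smul_mem _
        (sub_mem (mul_mem xh ye) (mul_mem xe yh)) _) (sub_mem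
        (Subalgebra.smul_mem _ (D_mem_regular ye) _) (Subalgebra.smul_mem _ (D_mem_regular xe) _)))
    · refine proj_of_mem_regular _ (add_mem (Subalgebra.smul_mem _
        (sub_mem (mul_mem xh yf) (mul_mem xf yh)) _) (sub_mem
        (Subalgebra.smul_mem _ (D_mem_regular yf) _) (Subalgebra.smul_mem _ (D_mem_regular xf) _)))
    · exact res_regular (add_mem (add_mem (Subalgebra.smul_mem _
        (mul_mem (D_mem_regular xh) yh) _) (mul_mem (D_mem_regular xe) yf))
        (mul_mem (D_mem_regular xf) ye))
    · rfl

/-! ### The series of the universal r-matrix -/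

/-- The index set as a sum type. -/
def rIndexEquiv : (ℕ ⊕ ℕ) ⊕ (ℕ ⊕ Unit) ≃ RIndex where
  toFun := Sum.elim (Sum.elim .hTerm .fTerm) (Sum.elim .eTerm fun _ => .cTerm)
  invFun
    | .hTerm n => .inl (.inl n)
    | .fTerm n => .inl (.inr n)
    | .eTerm n => .inr (.inl n)
    | .cTerm => .inr (.inr ())
  left_inv := by rintro ((n | n) | (n | n)) <;> rfl
  right_inv := by rintro (n | n | n | _) <;> rfl

theorem hasSum_rIndex {f : RIndex → ℂ} {p q r : ℂ} (hp : HasSum (fun n => f (.hTerm n)) p)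
    (hq : HasSum (fun n => f (.fTerm n)) q) (hr : HasSum (fun n => f (.eTerm n)) r) :
    HasSum f ((p + q) + (r + f .cTerm)) := by
  rw [← rIndexEquiv.hasSum_iff]
  exact HasSum.sum (HasSum.sum hp hq)
    (HasSum.sum hr (hasSum_unique (fun u : Unit => f .cTerm)))

theorem hasSum_proj (g s : K0) {ψ : K0 → ℂ} (hψ : IsLinearMap ℂ ψ) :
    HasSum (fun n => moments s n * ψ ((n.factorial : ℂ)⁻¹ • (K0.D ^ n) g)) (ψ (proj g s)) := by
  have e : ψ (proj g s) =
      ∑ n ∈ (moments s).support, moments s n * ψ ((n.factorial : ℂ)⁻¹ • (K0.D ^ n) g) := by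
    rw [proj_apply, ← hψ.mk'_apply, map_finsuppSum]
    exact Finset.sum_congr rfl fun n _ => (map_smul (hψ.mk' ψ) _ _).trans rfl
  rw [e]
  refine hasSum_sum_of_ne_finset_zero fun n hn => ?_
  rw [Finsupp.notMem_support_iff.1 hn, zero_mul]

theorem legRight_eTerm (τ : UpperHalfPlane) (lam : ℂ) (n : ℕ) :
    legRight τ lam (.eTerm n) = ff (coord ^ n) := by
  have : -(n : ℤ) - 1 = Int.negSucc n := by rw [Int.negSucc_eq]; ring
  rw [legRight, this, epsUp_negSucc]

theorem legLeft_eTerm (τ : UpperHalfPlane) (lam : ℂ) (n : ℕ) : legLeft τ lam (.eTerm n) =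
    ((-1 : ℂ) ^ n) • ee ((n.factorial : ℂ)⁻¹ • (K0.D ^ n) (greenGerm τ (-lam))) := by
  have : -(n : ℤ) - 1 = Int.negSucc n := by rw [Int.negSucc_eq]; ring
  rw [legLeft, this, epsDown_negSucc, mul_smul]
  ext <;> simp [ee]

theorem form_legRight_hTerm (τ : UpperHalfPlane) (lam : ℂ) (n : ℕ) (y : CurrentAlgebra) :
    form (legRight τ lam (.hTerm n)) y = 2 * moments y.h n := form_hh _ _

theorem form_legRight_fTerm (τ : UpperHalfPlane) (lam : ℂ) (n : ℕ) (y : CurrentAlgebra) :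
    form (legRight τ lam (.fTerm n)) y = moments y.f n := form_ee _ _

theorem form_legRight_eTerm (τ : UpperHalfPlane) (lam : ℂ) (n : ℕ) (y : CurrentAlgebra) :
    form (legRight τ lam (.eTerm n)) y = (-1) ^ n * moments y.e n := by
  rw [legRight_eTerm, form_ff, moments_apply, res_neg_coord_pow_mul, ← mul_assoc, ← mul_pow]
  simp

/-- The exponent of the power of `u` in the second factor. -/
def rDegree : RIndex → ℕ
  | .hTerm n => n
  | .fTerm n => n
  | .eTerm n => n
  | .cTerm => 0

theorem finite_rDegree_lt (N : ℕ) : {i | rDegree i < N}.Finite := by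
  refine ((((Set.finite_Iio N).image RIndex.hTerm).union
    ((Set.finite_Iio N).image RIndex.fTerm)).union
    (((Set.finite_Iio N).image RIndex.eTerm).union (Set.finite_singleton RIndex.cTerm))).subset ?_
  rintro (n | n | n | _) hn
  · exact Or.inl (Or.inl ⟨n, hn, rfl⟩)
  · exact Or.inl (Or.inr ⟨n, hn, rfl⟩)
  · exact Or.inr (Or.inl ⟨n, hn, rfl⟩)
  · exact Or.inr (Or.inr rfl)

/-- The second factors annihilate the elements with poles of a smaller order. -/
theorem form_legRight_eq_zero (τ : UpperHalfPlane) (lam : ℂ) {w : CurrentAlgebra} {N : ℕ}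
    (hh : ∀ n ≥ N, coord ^ n * w.h ∈ regular) (he : ∀ n ≥ N, coord ^ n * w.e ∈ regular)
    (hf : ∀ n ≥ N, coord ^ n * w.f ∈ regular) {i : RIndex} (hi : N + 1 ≤ rDegree i) :
    form (legRight τ lam i) w = 0 := by
  have key : ∀ n (s : K0), coord ^ n * s ∈ regular → moments s n = 0 := fun n s hs => by
    rw [moments_apply, res_neg_coord_pow_mul, res_regular hs, mul_zero]
  obtain n | n | n | _ := i
  · rw [form_legRight_hTerm, key n _ (hh n (Nat.le_of_succ_le hi)), mul_zero]
  · rw [form_legRight_fTerm, key n _ (hf n (Nat.le_of_succ_le hi))]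
  · rw [form_legRight_eTerm, key n _ (he n (Nat.le_of_succ_le hi)), mul_zero]
  · exact absurd hi (Nat.not_succ_le_zero N)

theorem legRight_regular (τ : UpperHalfPlane) (lam : ℂ) (i : RIndex) :
    (legRight τ lam i).h ∈ regular ∧ (legRight τ lam i).e ∈ regular ∧
      (legRight τ lam i).f ∈ regular := by
  have hc := fun n : ℕ => pow_mem coord_mem_regular n
  have hc' := fun n : ℕ => pow_mem (neg_mem coord_mem_regular) n
  have h0 := zero_mem regular
  obtain n | n | n | _ := i
  · exact ⟨hc' n, h0, h0⟩
  · exact ⟨h0, hc' n, h0⟩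
  · rw [legRight_eTerm]
    exact ⟨h0, h0, hc n⟩
  · exact ⟨h0, h0, h0⟩

theorem isTensorExpansion_polarPart (τ : UpperHalfPlane) (lam : ℂ) :
    IsTensorExpansion form (polarPart τ lam) (legLeft τ lam) (legRight τ lam) where
  hasSum ψ hψ y := by
    have h1 := hasSum_proj (greenGerm τ 0) y.h (ψ := fun s => ψ (hh s))
      ⟨fun s t => by rw [← hψ.map_add]; congr 1; ext <;> simp [hh],
        fun a s => by rw [← hψ.map_smul]; congr 1; ext <;> simp [hh]⟩
    have h2 := hasSum_proj (greenGerm τ lam) y.f (ψ := fun s => ψ (ff s))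
      ⟨fun s t => by rw [← hψ.map_add]; congr 1; ext <;> simp [ff],
        fun a s => by rw [← hψ.map_smul]; congr 1; ext <;> simp [ff]⟩
    have h3 := hasSum_proj (greenGerm τ (-lam)) y.e (ψ := fun s => ψ (ee s))
      ⟨fun s t => by rw [← hψ.map_add]; congr 1; ext <;> simp [ee],
        fun a s => by rw [← hψ.map_smul]; congr 1; ext <;> simp [ee]⟩
    have h := hasSum_rIndex (f := fun i => form (legRight τ lam i) y * ψ (legLeft τ lam i))
      (h1.congr_fun ?_) (h2.congr_fun ?_) (h3.congr_fun ?_)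
    · convert! h using 1
      have e : polarPart τ lam y =
          (hh (proj (greenGerm τ 0) y.h) + ff (proj (greenGerm τ lam) y.f)) +
          (ee (proj (greenGerm τ (-lam)) y.e) + y.c • cc) := by
        ext <;> simp [polarPart, hh, ee, ff, cc]
      have e2 : form (legRight τ lam .cTerm) y = y.c := form_dd y
      rw [e, hψ.map_add, hψ.map_add, hψ.map_add, hψ.map_smul, e2]
      rfl
    · intro n
      rw [form_legRight_hTerm]
      -- The coefficient `1 / 2` of the term compensates for `(h, h) = 2`.
      change 2 * moments y.h n * ψ ((1 / 2 : ℂ) • hh _) = _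
      rw [hψ.map_smul, smul_eq_mul]
      change _ = moments y.h n * ψ (hh (epsUp τ 0 n))
      ring
    · intro n
      rw [form_legRight_fTerm]
      rfl
    · intro n
      have : ((-1 : ℂ) ^ n) * (-1) ^ n = 1 := by rw [← mul_pow]; simp
      rw [form_legRight_eTerm, legLeft_eTerm, hψ.map_smul, smul_eq_mul]
      linear_combination (moments y.e n *
        ψ (ee ((n.factorial : ℂ)⁻¹ • (K0.D ^ n) (greenGerm τ (-lam))))) * this
  finite y := by
    refine ((((moments y.h).hasFiniteSupport.image RIndex.hTerm).union
      ((moments y.f).hasFiniteSupport.image RIndex.fTerm)).union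
      (((moments y.e).hasFiniteSupport.image RIndex.eTerm).union
        (Set.finite_singleton RIndex.cTerm))).subset ?_
    rintro (n | n | n | _) hn
    · refine Or.inl (Or.inl ⟨n, fun h0 => hn ?_, rfl⟩)
      rw [form_legRight_hTerm, h0, mul_zero]
    · refine Or.inl (Or.inr ⟨n, fun h0 => hn ?_, rfl⟩)
      rw [form_legRight_fTerm, h0]
    · refine Or.inr (Or.inl ⟨n, fun h0 => hn ?_, rfl⟩)
      rw [form_legRight_eTerm, h0, mul_zero]
    · exact Or.inr (Or.inr rfl)
  finite_lie z := by
    obtain ⟨N, hN⟩ : ∃ N : ℕ, ∀ n ≥ N, ∀ s ∈ [z.h, z.e, z.f, K0.D z.h, K0.D z.e, K0.D z.f],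
        coord ^ n * s ∈ regular := by
      choose M hM using exists_coord_pow_mul_mem
      refine ⟨M z.h + M z.e + M z.f + M (K0.D z.h) + M (K0.D z.e) + M (K0.D z.f),
        fun n hn s hs => hM s n ?_⟩
      simp only [List.mem_cons, List.not_mem_nil, or_false] at hs
      rcases hs with rfl | rfl | rfl | rfl | rfl | rfl <;> omega
    simp only [List.forall_mem_cons, List.not_mem_nil, false_imp_iff, implies_true, and_true] at hN
    -- The order of the poles of the brackets with the second factors is bounded uniformly.
    have key : ∀ i j, N + 1 ≤ rDegree i → form (legRight τ lam i) ⁅legRight τ lam j, z⁆ = 0 := by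
      intro i j hi
      obtain ⟨bh, be, bf⟩ := legRight_regular τ lam j
      generalize legRight τ lam j = b at *
      have hp := fun n : ℕ => pow_mem coord_mem_regular n
      refine form_legRight_eq_zero τ lam (N := N) (fun n hn => ?_) (fun n hn => ?_)
        (fun n hn => ?_) hi
      · obtain ⟨zh, ze, zf, dh, de, df⟩ := hN n hn
        have e : coord ^ n * ⁅b, z⁆.h = b.e * (coord ^ n * z.f) - b.f * (coord ^ n * z.e) +
            (b.d • (coord ^ n * K0.D z.h) - z.d • (coord ^ n * K0.D b.h)) := by
          rw [bracket_h]; simp only [Algebra.smul_def]; ring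
        rw [e]
        exact add_mem (sub_mem (mul_mem be zf) (mul_mem bf ze)) (sub_mem
          (Subalgebra.smul_mem _ dh _)
          (Subalgebra.smul_mem _ (mul_mem (hp n) (D_mem_regular bh)) _))
      · obtain ⟨zh, ze, zf, dh, de, df⟩ := hN n hn
        have e : coord ^ n * ⁅b, z⁆.e = (2 : ℂ) • (b.h * (coord ^ n * z.e) -
            b.e * (coord ^ n * z.h)) +
            (b.d • (coord ^ n * K0.D z.e) - z.d • (coord ^ n * K0.D b.e)) := by
          rw [bracket_e]; simp only [Algebra.smul_def]; ring
        rw [e]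
        exact add_mem (Subalgebra.smul_mem _ (sub_mem (mul_mem bh ze) (mul_mem be zh)) _) (sub_mem
          (Subalgebra.smul_mem _ de _)
          (Subalgebra.smul_mem _ (mul_mem (hp n) (D_mem_regular be)) _))
      · obtain ⟨zh, ze, zf, dh, de, df⟩ := hN n hn
        have e : coord ^ n * ⁅b, z⁆.f = (-2 : ℂ) • (b.h * (coord ^ n * z.f) -
            b.f * (coord ^ n * z.h)) +
            (b.d • (coord ^ n * K0.D z.f) - z.d • (coord ^ n * K0.D b.f)) := by
          rw [bracket_f]; simp only [Algebra.smul_def]; ring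
        rw [e]
        exact add_mem (Subalgebra.smul_mem _ (sub_mem (mul_mem bh zf) (mul_mem bf zh)) _) (sub_mem
          (Subalgebra.smul_mem _ df _)
          (Subalgebra.smul_mem _ (mul_mem (hp n) (D_mem_regular bf)) _))
    refine ((finite_rDegree_lt (N + 1)).prod (finite_rDegree_lt (N + 1))).subset ?_
    rintro ⟨i, j⟩ hij
    constructor
    · by_contra hlt
      exact hij (by rw [form_invariant]; exact key i j (not_lt.1 hlt))
    · by_contra hlt
      refine hij ?_
      rw [← lie_skew, map_neg, LinearMap.neg_apply, form_invariant, key j i (not_lt.1 hlt),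
        neg_zero]

theorem rMatrix_eq (τ : UpperHalfPlane) (lam : ℂ) :
    rMatrix τ lam = fun x => form (polarPart τ lam (x 1)) (x 0) :=
  (isTensorExpansion_polarPart τ lam).hasSum_pureTensor.tsum_eq

/-! ### The derivative of the r-matrix and the Yang-Baxter equation -/

theorem hasDerivAt_rMatrix (τ : UpperHalfPlane) {lam : ℂ} (h : theta τ lam ≠ 0)
    (x : Fin 2 → CurrentAlgebra) :
    HasDerivAt (fun l => rMatrix τ l x)
      (K0.res (proj (greenDotGerm τ (-lam)) (x 0).e * (x 1).f) -
        K0.res (proj (greenDotGerm τ (-lam)) (x 1).e * (x 0).f)) lam := by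
  simp only [rMatrix_eq, form_polarPart]
  have h1 := hasDerivAt_res_proj_neg τ h (x 1).e (x 0).f
  have h2 := hasDerivAt_res_proj τ h (x 1).f (x 0).e
  rw [res_proj_greenDot τ h] at h2
  refine (((h1.const_add _).add h2).add_const _).congr_deriv ?_
  ring

theorem rMatrixDeriv_apply (τ : UpperHalfPlane) {lam : ℂ} (h : theta τ lam ≠ 0)
    (x : Fin 2 → CurrentAlgebra) : rMatrixDeriv τ lam x =
      K0.res (proj (greenDotGerm τ (-lam)) (x 0).e * (x 1).f) -
        K0.res (proj (greenDotGerm τ (-lam)) (x 1).e * (x 0).f) :=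
  (hasDerivAt_rMatrix τ h x).deriv

theorem rMatrixDeriv_mem (τ : UpperHalfPlane) {lam : ℂ} (h : theta τ lam ≠ 0) :
    rMatrixDeriv τ lam ∈ completedTensor form 2 := by
  intro i x
  fin_cases i
  · refine ⟨ff (proj (greenDotGerm τ lam) (x 1).f) - ee (proj (greenDotGerm τ (-lam)) (x 1).e),
      fun y => ?_⟩
    rw [rMatrixDeriv_apply τ h, map_sub, LinearMap.sub_apply, form_ff, form_ee,
      res_proj_greenDot τ h]
    rfl
  · refine ⟨ee (proj (greenDotGerm τ (-lam)) (x 0).e) - ff (proj (greenDotGerm τ lam) (x 0).f),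
      fun y => ?_⟩
    rw [rMatrixDeriv_apply τ h, map_sub, LinearMap.sub_apply, form_ff, form_ee,
      res_proj_greenDot τ h]
    rfl

/-- The form is a sum over the six ways of distributing `h`, `e`, `f` to the three arguments, each
of which is a residue of a product of three projections. -/
theorem form_polarPart_lie (τ : UpperHalfPlane) {lam : ℂ} (h : theta τ lam ≠ 0)
    (x : Fin 3 → CurrentAlgebra) :
    form (polarPart τ lam (x 0)) ⁅polarPart τ lam (x 1), polarPart τ lam (x 2)⁆ =
      (insertAt form 0 (hh 1) (rMatrixDeriv τ lam) - insertAt form 1 (hh 1) (rMatrixDeriv τ lam) +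
        insertAt form 2 (hh 1) (rMatrixDeriv τ lam)) x := by
  set K : K0 → K0 → ℂ := fun s t => K0.res (proj (greenDotGerm τ (-lam)) s * t) with hK
  have key : ∀ p q r : CurrentAlgebra, K0.res ((polarPart τ lam p).h * (polarPart τ lam q).e *
      (polarPart τ lam r).f) = K0.res p.h * K q.e r.f := fun p q r =>
    res_proj_mul_proj_mul_proj τ h p.h q.e r.f
  have hd : ∀ p, (polarPart τ lam p).d = 0 := fun p => rfl
  have hr : (insertAt form 0 (hh 1) (rMatrixDeriv τ lam) -
      insertAt form 1 (hh 1) (rMatrixDeriv τ lam) + insertAt form 2 (hh 1) (rMatrixDeriv τ lam)) x =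
      2 * K0.res (x 0).h * (K (x 1).e (x 2).f - K (x 2).e (x 1).f) -
      2 * K0.res (x 1).h * (K (x 0).e (x 2).f - K (x 2).e (x 0).f) +
      2 * K0.res (x 2).h * (K (x 0).e (x 1).f - K (x 1).e (x 0).f) := by
    simp only [Pi.add_apply, Pi.sub_apply, insertAt, rMatrixDeriv_apply τ h, form_hh, one_mul]
    rfl
  rw [hr]
  have k1 := key (x 0) (x 1) (x 2)
  have k2 := key (x 0) (x 2) (x 1)
  have k3 := key (x 1) (x 0) (x 2)
  have k4 := key (x 1) (x 2) (x 0)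
  have k5 := key (x 2) (x 0) (x 1)
  have k6 := key (x 2) (x 1) (x 0)
  rw [form_apply, bracket_h, bracket_e, bracket_f, bracket_d]
  simp only [hd, zero_smul, sub_zero, add_zero, zero_mul, mul_zero]
  generalize polarPart τ lam (x 0) = a at *
  generalize polarPart τ lam (x 1) = b at *
  generalize polarPart τ lam (x 2) = c at *
  have e : (2 : ℂ) • (a.h * (b.e * c.f - b.f * c.e)) + a.e * ((-2 : ℂ) • (b.h * c.f - b.f * c.h)) +
      a.f * ((2 : ℂ) • (b.h * c.e - b.e * c.h)) =
      (2 : ℂ) • (a.h * b.e * c.f - a.h * c.e * b.f - b.h * a.e * c.f + b.h * c.e * a.f +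
        c.h * a.e * b.f - c.h * b.e * a.f) := by
    simp only [Algebra.smul_def, map_neg]
    ring
  rw [e]
  simp only [map_smul, map_add, map_sub, smul_eq_mul, k1, k2, k3, k4, k5, k6]
  ring

theorem yangBaxter_eq_form (τ : UpperHalfPlane) {lam : ℂ} (h : theta τ lam ≠ 0) :
    yangBaxter τ lam = fun x =>
      form (polarPart τ lam (x 0)) ⁅polarPart τ lam (x 1), polarPart τ lam (x 2)⁆ := by
  have hQ := isIsotropicSplitting_polarPart τ h
  have hE := isTensorExpansion_polarPart τ lam
  have h1 : (∑' p, term1213 τ lam p) = _ := hE.hasSum_lie_left.tsum_eq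
  have h2 : (∑' p, term1223 τ lam p) = _ := (hE.hasSum_lie_middle hQ).tsum_eq
  have h3 : (∑' p, term1323 τ lam p) = _ := (hE.hasSum_lie_right hQ).tsum_eq
  rw [yangBaxter, h1, h2, h3]
  ext x
  exact IsTensorExpansion.yangBaxter_eq hQ (x 0) (x 1) (x 2)

end EllipticCurrent
end

open EllipticCurrent EllipticCurrent.CurrentAlgebra
theorem proposition5 (τ : UpperHalfPlane) (lam : ℂ) (hlam : lam ∉ lattice τ) :
    -- the two families of functions are dual to each other
    (∀ n m : ℤ, K0.res (epsUp τ lam n * epsDown τ lam m) = if n = m then 1 else 0) ∧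
    (∀ n m : ℤ, K0.res (epsUp τ 0 n * epsDown τ 0 m) = if n = m then 1 else 0) ∧
    -- the series of the universal r-matrix converges, and is differentiable in the parameter
    Summable (rTerm τ lam) ∧
    rMatrix τ lam ∈ completedTensor form 2 ∧
    (∀ x, DifferentiableAt ℂ (fun l => rMatrix τ l x) lam) ∧
    rMatrixDeriv τ lam ∈ completedTensor form 2 ∧
    -- the classical dynamical Yang-Baxter equation
    Summable (term1213 τ lam) ∧ Summable (term1223 τ lam) ∧ Summable (term1323 τ lam) ∧
    yangBaxter τ lam =
      insertAt form 0 (hh 1) (rMatrixDeriv τ lam) - insertAt form 1 (hh 1) (rMatrixDeriv τ lam) +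
        insertAt form 2 (hh 1) (rMatrixDeriv τ lam) ∧
    -- the symmetric part of the r-matrix
    rMatrix τ lam + swapFactors (rMatrix τ lam) = casimir form ∧
    -- the quasi-Lie bialgebra
    (∀ x, Summable (cobracketTerm τ lam x)) ∧
    IsQuasiLieBialgebra form (cobracket τ lam) (-yangBaxter τ lam) := by
  have h := theta_ne_zero τ hlam
  have hQ := isIsotropicSplitting_polarPart τ h
  have hE := isTensorExpansion_polarPart τ lam
  have hco : cobracket τ lam = splittingCobracket form (polarPart τ lam) :=
    funext fun w => (hE.hasSum_cobracket hQ w).tsum_eq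
  have hyb : -yangBaxter τ lam = splittingAssociator form (polarPart τ lam) := by
    rw [yangBaxter_eq_form τ h]
    rfl
  refine ⟨res_epsUp_mul_epsDown τ (Or.inr h), res_epsUp_mul_epsDown τ (Or.inl rfl),
    hE.hasSum_pureTensor.summable, ?_, fun x => (hasDerivAt_rMatrix τ h x).differentiableAt,
    rMatrixDeriv_mem τ h, hE.hasSum_lie_left.summable, (hE.hasSum_lie_middle hQ).summable,
    (hE.hasSum_lie_right hQ).summable, ?_, ?_, fun w => (hE.hasSum_cobracket hQ w).summable, ?_⟩
  · rw [rMatrix_eq]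
    intro i x
    fin_cases i
    · exact ⟨polarPart τ lam (x 1), fun y => by simp⟩
    · refine ⟨x 0 - polarPart τ lam (x 0), fun y => ?_⟩
      simp only [← hQ.form_Q_right]
      exact form_symm _ _
  · rw [yangBaxter_eq_form τ h]
    exact funext (form_polarPart_lie τ h)
  · rw [rMatrix_eq]
    ext x
    change form (polarPart τ lam (x 1)) (x 0) + form (polarPart τ lam (x 0)) (x 1) =
      form (x 0) (x 1)
    rw [form_symm _ (x 0), add_comm, hQ.adjoint]
  · rw [hco, hyb]
    exact hQ.isQuasiLieBialgebra
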